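/- Let $S$ be an inverse semigroup with unit $1$; write $s^*$ for the generalized inverse of $s$ and $s\le t$ if $s=te$ for some idempotent $e$. A (not necessarily saturated) Fell bundle $\mathcal A=(A_s)_{s\in S}$ over $S$ consists of complex Banach spaces $A_s$, bilinear associative multiplications $A_s\times A_t\to A_{st}$ with $\|ab\|\le\|a\|\|b\|$, isometric conjugate-linear involutions $A_s\to A_{s^*}$ with $a^{**}=a$ and $(ab)^*=b^*a^*$, and isometric linear inclusions $A_s\subseteq A_t$ for $s\le t$, functorial and compatible with multiplication and involution, such that $\|a^*a\|=\|a\|^2$ and $a^*a$ is a positive element of the $C^*$-algebra $A_{s^*s}$ for every $a\in A_s$. Let $C_c(\mathcal A)$ be the $^*$-algebra of finitely supported sections, spanned by elements $a\delta_s$ ($a\in A_s$), with $(a\delta_s)(b\delta_t)=(ab)\delta_{st}$ and $(a\delta_s)^*=a^*\delta_{s^*}$. The full cross-sectional $C^*$-algebra $C^*(\mathcal A)$ is the Hausdorff completion of $C_c(\mathcal A)$ in the largest $C^*$-seminorm that vanishes on all $a\delta_s-a\delta_t$ with $s\le t$ and $a\in A_s\subseteq A_t$. View all $A_s$ inside $C^*(\mathcal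 A)\subseteq C^*(\mathcal A)''$, the enveloping von Neumann algebra, and let $A_s''$ be the weak closure of $A_s$ there. For $s\in S$ let $I_{s,1}$ be the closed ideal of $A_1$ generated by the $A_{v^*v}$ with $v\le s$ and $v\le 1$, and let $1_s$ be the unit of $I_{s,1}''$. Let $C_c(\mathcal A'')$ be the space of finitely supported sections of $(A_s'')_{s\in S}$, with the multiplication and involution given by the same formulas, and let $P''\colon C_c(\mathcal A'')\to A_1''$ be the linear map with $P''(x\delta_s)=x1_s$. Let $\ell^2(\mathcal A'')$ be the Hausdorff completion of $C_c(\mathcal A'')$ in the norm $\|\langle\xi,\xi\rangle\|^{1/2}$ coming from the $A_1''$-valued semi-inner product $\langle\xi,\eta\rangle=P''(\xi^*\eta)$, and let $\Lambda(x)$, $x\in C_c(\mathcal A)$, be the operator of left multiplication by $x$ on $\ell^2(\mathcal A'')$. The reduced cross-sectional $C^*$-algebra $C^*_r(\mathcal A)$ is the Hausdorff completion of $C_c(\mathcal A)$ in the seminorm $\|x\|_r=\|\Lambda(x)\|$; the identity of $C_c(\mathcal A)$ extends to a $^*$-homomorphism $\Lambda\colon C^*(\mathcal A)\to C^*_r(\mathcal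 A)$, the regular representation. $\mathcal A$ has the approximation property if there is a net $(\xi_i)_{i\in I}$ of finitely supported functions $\xi_i\colon S\to A_1$ with $\xi_i(s)\in A_{ss^*}$ for all $s\in S$, such that (i) $\sup_{i}\bigl\|\sum_{p,t\in S}\xi_i(p)^*\xi_i(t)\,1_{pt^*}\bigr\|<\infty$, and (ii) for all $s\in S$ and $a\in A_s$, $\ \sum_{p,t\in S}1_{p(st)^*}\,\xi_i(p)^*\,a\,\xi_i(t)\to a$ in norm. **Theorem.** Let $\mathcal A$ be a Fell bundle over an inverse semigroup $S$ with unit. If $\mathcal A$ has the approximation property, then it has the weak containment property: the regular representation $\Lambda\colon C^*(\mathcal A)\to C^*_r(\mathcal A)$ is a $^*$-isomorphism. -/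

import Mathlib

universe u v w

/-- An inverse semigroup with unit: every `s` has a unique generalized inverse `s⁻¹`
(usually written `s^*`). -/
class InverseMonoid (S : Type u) extends Monoid S, Inv S where
  mul_inv_mul : ∀ s : S, s * s⁻¹ * s = s
  inv_mul_inv : ∀ s : S, s⁻¹ * s * s⁻¹ = s⁻¹
  inv_unique : ∀ s t : S, s * t * s = s → t * s * t = t → t = s⁻¹

namespace InverseMonoid

variable {S : Type u} [InverseMonoid S]

/-- The natural partial order: `s ≤ t` iff `s = t e` for some idempotent `e`. -/
instance instLE : LE S := ⟨fun s t => ∃ e : S, e * e = e ∧ t * e = s⟩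

theorem le_def {s t : S} : s ≤ t ↔ ∃ e : S, e * e = e ∧ t * e = s := Iff.rfl

theorem inv_inv' (s : S) : s⁻¹⁻¹ = s :=
  (inv_unique s⁻¹ s (inv_mul_inv s) (mul_inv_mul s)).symm

theorem inv_of_idem {e : S} (he : e * e = e) : e⁻¹ = e :=
  (inv_unique e e (by rw [he, he]) (by rw [he, he])).symm

theorem one_inv' : (1 : S)⁻¹ = 1 := inv_of_idem (mul_one 1)

theorem idem_inv_mul (s : S) : (s⁻¹ * s) * (s⁻¹ * s) = s⁻¹ * s := by
  rw [← mul_assoc, inv_mul_inv]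

theorem idem_mul_inv (s : S) : (s * s⁻¹) * (s * s⁻¹) = s * s⁻¹ := by
  rw [← mul_assoc, mul_inv_mul]

theorem idem_mul {e f : S} (he : e * e = e) (hf : f * f = f) :
    (e * f) * (e * f) = e * f := by
  have h1 := mul_inv_mul (e * f)
  have h2 := inv_mul_inv (e * f)
  set x := (e * f)⁻¹ with hx
  have hy : f * x * e = x := by
    apply inv_unique (e * f)
    · calc e * f * (f * x * e) * (e * f) = e * (f * f) * x * (e * e) * f := by
            simp only [mul_assoc]
        _ = e * f * x * (e * f) := by rw [he, hf]; simp only [mul_assoc]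
        _ = e * f := h1
    · calc f * x * e * (e * f) * (f * x * e) = f * (x * ((e * e) * (f * f)) * x) * e := by
            simp only [mul_assoc]
        _ = f * x * e := by rw [he, hf, h2]
  have hxx : x * x = x := by
    calc x * x = f * x * e * (f * x * e) := by rw [hy]
      _ = f * (x * (e * f) * x) * e := by simp only [mul_assoc]
      _ = x := by rw [h2, hy]
  have : e * f = x := by
    rw [← inv_inv' (e * f), ← hx, inv_of_idem hxx]
  rw [this, hxx]

theorem idem_comm {e f : S} (he : e * e = e) (hf : f * f = f) : e * f = f * e := by
  have h1 := idem_mul he hf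
  have h2 := idem_mul hf he
  have h : f * e = (e * f)⁻¹ := by
    apply inv_unique
    · calc e * f * (f * e) * (e * f) = e * (f * f) * (e * e) * f := by simp only [mul_assoc]
        _ = e * f * (e * f) := by rw [he, hf]; simp only [mul_assoc]
        _ = e * f := h1
    · calc f * e * (e * f) * (f * e) = f * (e * e) * (f * f) * e := by simp only [mul_assoc]
        _ = f * e * (f * e) := by rw [he, hf]; simp only [mul_assoc]
        _ = f * e := h2
  rw [h, inv_of_idem h1]

theorem mul_inv_rev' (s t : S) : (s * t)⁻¹ = t⁻¹ * s⁻¹ := by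
  symm
  have hc := idem_comm (idem_mul_inv t) (idem_inv_mul s)
  apply inv_unique
  · calc s * t * (t⁻¹ * s⁻¹) * (s * t) = s * ((t * t⁻¹) * (s⁻¹ * s)) * t := by
          simp only [mul_assoc]
      _ = (s * s⁻¹ * s) * (t * t⁻¹ * t) := by rw [hc]; simp only [mul_assoc]
      _ = s * t := by rw [mul_inv_mul, mul_inv_mul]
  · calc t⁻¹ * s⁻¹ * (s * t) * (t⁻¹ * s⁻¹) = t⁻¹ * ((s⁻¹ * s) * (t * t⁻¹)) * s⁻¹ := by
          simp only [mul_assoc]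
      _ = (t⁻¹ * t * t⁻¹) * (s⁻¹ * s * s⁻¹) := by rw [← hc]; simp only [mul_assoc]
      _ = t⁻¹ * s⁻¹ := by rw [inv_mul_inv, inv_mul_inv]

/-- Conjugates of idempotents are idempotent. -/
theorem idem_conj (s : S) {e : S} (he : e * e = e) :
    (s * e * s⁻¹) * (s * e * s⁻¹) = s * e * s⁻¹ := by
  calc (s * e * s⁻¹) * (s * e * s⁻¹) = s * (e * (s⁻¹ * s)) * e * s⁻¹ := by simp only [mul_assoc]
    _ = (s * s⁻¹ * s) * (e * e) * s⁻¹ := by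
        rw [idem_comm he (idem_inv_mul s)]; simp only [mul_assoc]
    _ = s * e * s⁻¹ := by rw [mul_inv_mul, he]

theorem idem_mul_eq {e : S} (he : e * e = e) (t : S) : e * t = t * (t⁻¹ * e * t) := by
  calc e * t = e * (t * t⁻¹) * t := by rw [mul_assoc, mul_inv_mul]
    _ = t * (t⁻¹ * e * t) := by rw [idem_comm he (idem_mul_inv t)]; simp only [mul_assoc]

theorem idem_conj' (s : S) {e : S} (he : e * e = e) :
    (s⁻¹ * e * s) * (s⁻¹ * e * s) = s⁻¹ * e * s := by
  simpa only [inv_inv'] using idem_conj s⁻¹ he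

theorem le_of_eq' {s t : S} (h : s = t) : s ≤ t := ⟨1, mul_one 1, by rw [mul_one, h]⟩

theorem le_refl' (s : S) : s ≤ s := le_of_eq' rfl

theorem le_trans' {r s t : S} (h₁ : r ≤ s) (h₂ : s ≤ t) : r ≤ t := by
  obtain ⟨e, he, rfl⟩ := h₁
  obtain ⟨f, hf, rfl⟩ := h₂
  exact ⟨f * e, idem_mul hf he, (mul_assoc _ _ _).symm⟩

theorem mul_le_mul'' {r r' s s' : S} (h₁ : r ≤ r') (h₂ : s ≤ s') : r * s ≤ r' * s' := by
  obtain ⟨e, he, rfl⟩ := h₁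
  obtain ⟨f, hf, rfl⟩ := h₂
  refine ⟨(s'⁻¹ * e * s') * f, idem_mul (idem_conj' s' he) hf, ?_⟩
  calc r' * s' * (s'⁻¹ * e * s' * f) = r' * (s' * (s'⁻¹ * e * s')) * f := by
        simp only [mul_assoc]
    _ = r' * e * (s' * f) := by rw [← idem_mul_eq he]; simp only [mul_assoc]

theorem inv_le_inv' {s t : S} (h : s ≤ t) : s⁻¹ ≤ t⁻¹ := by
  obtain ⟨e, he, rfl⟩ := h
  refine ⟨t * e * t⁻¹, idem_conj t he, ?_⟩
  rw [mul_inv_rev', inv_of_idem he, idem_mul_eq he t⁻¹, inv_inv']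

theorem idem_le_one {e : S} (he : e * e = e) : e ≤ 1 := ⟨e, he, one_mul e⟩

theorem inv_mul_le_one (s : S) : s⁻¹ * s ≤ 1 := idem_le_one (idem_inv_mul s)

theorem mul_inv_le_one (s : S) : s * s⁻¹ ≤ 1 := idem_le_one (idem_mul_inv s)

theorem idem_of_le_one {e : S} (h : e ≤ 1) : e * e = e := by
  obtain ⟨f, hf, rfl⟩ := h
  rw [one_mul, hf]

theorem mul_idem_le (s : S) {e : S} (he : e * e = e) : s * e ≤ s := ⟨e, he, rfl⟩

theorem idem_mul_le {e : S} (he : e * e = e) (s : S) : e * s ≤ s :=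
  ⟨s⁻¹ * e * s, idem_conj' s he, (idem_mul_eq he s).symm⟩

theorem le_inv_of_idem_le {e s : S} (he : e * e = e) (h : e ≤ s) : e ≤ s⁻¹ := by
  simpa only [inv_of_idem he] using inv_le_inv' h

theorem conj_inv_mul_self (s : S) : (s⁻¹ * s)⁻¹ * (s⁻¹ * s) = s⁻¹ * s := by
  rw [inv_of_idem (idem_inv_mul s), idem_inv_mul]

end InverseMonoid

open InverseMonoid

/-- A (not necessarily saturated) Fell bundle over an inverse semigroup `S` with unit, with its
multiplication maps, involutions and inclusion maps. The inclusions along equalities `s = t` serve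
to compare fibres whose indices are equal but not syntactically so. The fibre `A_s` is a Hilbert
`A_1`-`A_1`-bimodule with inner products `a^* b` and `a b^*`. -/
structure FellBundle (S : Type u) [InverseMonoid S] where
  /-- the fibre `A_s`, a Banach space -/
  fiber : S → Type v
  [normedAddCommGroup : ∀ s, NormedAddCommGroup (fiber s)]
  [normedSpace : ∀ s, NormedSpace ℂ (fiber s)]
  [completeSpace : ∀ s, CompleteSpace (fiber s)]
  /-- the multiplication `A_s × A_t → A_{st}` -/
  mul : ∀ {s t : S}, fiber s →ₗ[ℂ] fiber t →ₗ[ℂ] fiber (s * t)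
  /-- the involution `A_s → A_{s^*}` -/
  adj : ∀ {s : S}, fiber s →ₗ⋆[ℂ] fiber s⁻¹
  /-- the inclusion `A_s ⊆ A_t` for `s ≤ t` -/
  incl : ∀ {s t : S}, s ≤ t → (fiber s →ₗᵢ[ℂ] fiber t)
  incl_refl : ∀ {s : S} (h : s ≤ s) (a : fiber s), incl h a = a
  incl_trans : ∀ {r s t : S} (h₁ : r ≤ s) (h₂ : s ≤ t) (h₃ : r ≤ t) (a : fiber r),
    incl h₂ (incl h₁ a) = incl h₃ a
  mul_assoc' : ∀ {r s t : S} (a : fiber r) (b : fiber s) (c : fiber t),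
    incl (le_of_eq' (mul_assoc r s t)) (mul (mul a b) c) = mul a (mul b c)
  norm_mul_le' : ∀ {s t : S} (a : fiber s) (b : fiber t), ‖mul a b‖ ≤ ‖a‖ * ‖b‖
  adj_adj : ∀ {s : S} (a : fiber s), incl (le_of_eq' (inv_inv' s)) (adj (adj a)) = a
  adj_mul : ∀ {s t : S} (a : fiber s) (b : fiber t),
    incl (le_of_eq' (mul_inv_rev' s t)) (adj (mul a b)) = mul (adj b) (adj a)
  norm_adj : ∀ {s : S} (a : fiber s), ‖adj a‖ = ‖a‖
  norm_adj_mul_self : ∀ {s : S} (a : fiber s), ‖mul (adj a) a‖ = ‖a‖ ^ 2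
  /-- `a^* a` is a positive element of the C*-algebra `A_{s^* s}` -/
  adj_mul_self_pos : ∀ {s : S} (a : fiber s), ∃ b : fiber (s⁻¹ * s),
    mul (adj a) a = incl (le_of_eq' (conj_inv_mul_self s)) (mul (adj b) b)
  incl_mul : ∀ {r r' s s' : S} (hr : r ≤ r') (hs : s ≤ s') (a : fiber r) (b : fiber s),
    incl (mul_le_mul'' hr hs) (mul a b) = mul (incl hr a) (incl hs b)
  incl_adj : ∀ {s t : S} (h : s ≤ t) (a : fiber s), incl (inv_le_inv' h) (adj a) = adj (incl h a)

attribute [instance] FellBundle.normedAddCommGroup FellBundle.normedSpace FellBundle.completeSpace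

/-- A C*-seminorm on a complex *-algebra. -/
structure CStarSeminorm (Q : Type u) [NonUnitalRing Q] [StarRing Q] [Module ℂ Q] extends
    Seminorm ℂ Q where
  mul_le' : ∀ x y : Q, toFun (x * y) ≤ toFun x * toFun y
  star_mul_self' : ∀ x : Q, toFun (star x * x) = toFun x ^ 2

namespace CStarSeminorm

variable {Q : Type u} [NonUnitalRing Q] [StarRing Q] [Module ℂ Q]

/-- Build a C*-seminorm from a submultiplicative seminorm with `p x ^ 2 ≤ p (x^* x)`. -/
def ofLe (p : Seminorm ℂ Q) (hmul : ∀ x y : Q, p (x * y) ≤ p x * p y)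
    (hstar : ∀ x : Q, p x ^ 2 ≤ p (star x * x)) : CStarSeminorm Q where
  toSeminorm := p
  mul_le' := hmul
  star_mul_self' x := by
    have key : ∀ y : Q, p y ≤ p (star y) := fun y => by
      by_contra! hlt
      have h1 := (hstar y).trans (hmul (star y) y)
      have h0 : 0 ≤ p (star y) := apply_nonneg p _
      nlinarith
    refine le_antisymm ?_ (hstar x)
    have h2 : p (star x) ≤ p x := by simpa using key (star x)
    calc p (star x * x) ≤ p (star x) * p x := hmul _ _
      _ ≤ p x * p x := by gcongr
      _ = p x ^ 2 := (sq _).symm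

theorem map_star (p : CStarSeminorm Q) (x : Q) : p.toSeminorm (star x) = p.toSeminorm x := by
  have key : ∀ y : Q, p.toSeminorm y ≤ p.toSeminorm (star y) := fun y => by
    by_contra! hlt
    have h1 : p.toSeminorm y ^ 2 ≤ p.toSeminorm (star y) * p.toSeminorm y :=
      (p.star_mul_self' y).symm.le.trans (p.mul_le' _ _)
    have h0 : 0 ≤ p.toSeminorm (star y) := apply_nonneg _ _
    nlinarith
  exact le_antisymm (by simpa using key (star x)) (key x)

/-- The *-algebra `Q`, regarded as a seminormed space through `p`. -/
def Carrier (p : CStarSeminorm Q) : Type u := Q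

variable (p : CStarSeminorm Q)

instance : NonUnitalRing p.Carrier := inferInstanceAs (NonUnitalRing Q)
instance : StarRing p.Carrier := inferInstanceAs (StarRing Q)
instance : Module ℂ p.Carrier := inferInstanceAs (Module ℂ Q)
instance [IsScalarTower ℂ Q Q] : IsScalarTower ℂ p.Carrier p.Carrier :=
  inferInstanceAs (IsScalarTower ℂ Q Q)
instance [SMulCommClass ℂ Q Q] : SMulCommClass ℂ p.Carrier p.Carrier :=
  inferInstanceAs (SMulCommClass ℂ Q Q)
instance [StarModule ℂ Q] : StarModule ℂ p.Carrier := inferInstanceAs (StarModule ℂ Q)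

/-- The identity map `Q → p.Carrier`. -/
def toCarrier : Q →ₗ[ℂ] p.Carrier := LinearMap.id

noncomputable instance : SeminormedAddCommGroup p.Carrier :=
  AddGroupSeminorm.toSeminormedAddCommGroup (E := p.Carrier)
    { toFun := p.toFun, map_zero' := p.map_zero', add_le' := p.add_le', neg' := p.neg' }

noncomputable instance : NonUnitalSeminormedRing p.Carrier where
  __ := (inferInstance : SeminormedAddCommGroup p.Carrier)
  __ := (inferInstance : NonUnitalRing p.Carrier)
  norm_mul_le := p.mul_le'

noncomputable instance : NormedSpace ℂ p.Carrier where
  norm_smul_le c x := (p.smul' c x).le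

instance : NormedStarGroup p.Carrier where
  norm_star_le x := (p.map_star x).le

theorem norm_toCarrier (x : Q) : ‖p.toCarrier x‖ = p.toSeminorm x := rfl

open UniformSpace UniformSpace.Completion Function

/-- The Hausdorff completion of `Q` with respect to the C*-seminorm `p`; it is a C*-algebra. -/
abbrev Compl : Type u := UniformSpace.Completion p.Carrier

noncomputable instance : Mul p.Compl :=
  ⟨curry <| (isDenseInducing_coe.prodMap isDenseInducing_coe).extend
    ((fun x : p.Carrier => (x : p.Compl)) ∘ uncurry (· * ·))⟩

theorem coe_mul' (a b : p.Carrier) : ((a * b : p.Carrier) : p.Compl) = a * b :=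
  ((isDenseInducing_coe.prodMap isDenseInducing_coe).extend_eq
    ((continuous_coe p.Carrier).comp (continuous_mul (M := p.Carrier))) (a, b)).symm

instance : ContinuousMul p.Compl where
  continuous_mul := by
    let m := (AddMonoidHom.mul : p.Carrier →+ p.Carrier →+ p.Carrier).compr₂ toCompl
    have : Continuous fun q : p.Carrier × p.Carrier => m q.1 q.2 :=
      (continuous_coe p.Carrier).comp continuous_mul
    have di : IsDenseInducing (toCompl : p.Carrier → p.Compl) := isDenseInducing_coe
    exact (di.extend_Z_bilin di this :)

noncomputable instance : Star p.Compl := ⟨Completion.map star⟩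

theorem uniformContinuous_star' : UniformContinuous (star : p.Carrier → p.Carrier) :=
  star_isometry.uniformContinuous

theorem coe_star' (a : p.Carrier) : ((star a : p.Carrier) : p.Compl) = star (a : p.Compl) :=
  (map_coe (uniformContinuous_star' p) a).symm

instance : ContinuousStar p.Compl := ⟨Completion.continuous_map⟩

noncomputable instance : NonUnitalRing p.Compl :=
  { (inferInstance : AddCommGroup p.Compl), (inferInstance : Mul p.Compl) with
    zero_mul a := by
      induction a using induction_on with
      | hp => exact isClosed_eq (by fun_prop) continuous_const
      | ih a => rw [← coe_zero, ← coe_mul', zero_mul]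
    mul_zero a := by
      induction a using induction_on with
      | hp => exact isClosed_eq (by fun_prop) continuous_const
      | ih a => rw [← coe_zero, ← coe_mul', mul_zero]
    mul_assoc a b c := by
      induction a, b, c using induction_on₃ with
      | hp => exact isClosed_eq (by fun_prop) (by fun_prop)
      | ih a b c => rw [← coe_mul', ← coe_mul', ← coe_mul', ← coe_mul', mul_assoc]
    left_distrib a b c := by
      induction a, b, c using induction_on₃ with
      | hp => exact isClosed_eq (by fun_prop) (by fun_prop)
      | ih a b c => rw [← coe_add, ← coe_mul', ← coe_mul', ← coe_mul', ← coe_add, mul_add]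
    right_distrib a b c := by
      induction a, b, c using induction_on₃ with
      | hp => exact isClosed_eq (by fun_prop) (by fun_prop)
      | ih a b c => rw [← coe_add, ← coe_mul', ← coe_mul', ← coe_mul', ← coe_add, add_mul] }

noncomputable instance : StarRing p.Compl where
  star_involutive a := by
    induction a using induction_on with
    | hp => exact isClosed_eq (by fun_prop) continuous_id
    | ih a => rw [← coe_star', ← coe_star', star_star]
  star_mul a b := by
    induction a, b using induction_on₂ with
    | hp => exact isClosed_eq (by fun_prop) (by fun_prop)
    | ih a b => rw [← coe_mul', ← coe_star', ← coe_star', ← coe_star', star_mul, coe_mul']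
  star_add a b := by
    induction a, b using induction_on₂ with
    | hp => exact isClosed_eq (by fun_prop) (by fun_prop)
    | ih a b => rw [← coe_add, ← coe_star', ← coe_star', ← coe_star', star_add, coe_add]

noncomputable instance : NonUnitalNormedRing p.Compl where
  __ := (inferInstance : NormedAddCommGroup p.Compl)
  __ := (inferInstance : NonUnitalRing p.Compl)
  norm_mul_le a b := by
    induction a, b using induction_on₂ with
    | hp => exact isClosed_le (by fun_prop) (by fun_prop)
    | ih a b => rw [← coe_mul', norm_coe, norm_coe, norm_coe]; exact norm_mul_le a b

instance : CStarRing p.Compl where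
  norm_mul_self_le a := by
    induction a using induction_on with
    | hp => exact isClosed_le (by fun_prop) (by fun_prop)
    | ih a =>
      rw [← coe_star', ← coe_mul', norm_coe, norm_coe, ← sq]
      exact (p.star_mul_self' a).symm.le

instance [IsScalarTower ℂ Q Q] : IsScalarTower ℂ p.Compl p.Compl where
  smul_assoc c a b := by
    rw [smul_eq_mul, smul_eq_mul]
    induction a, b using induction_on₂ with
    | hp =>
      exact isClosed_eq ((continuous_fst.const_smul c).mul continuous_snd)
        ((continuous_fst.mul continuous_snd).const_smul c)
    | ih a b => rw [← coe_smul, ← coe_mul', ← coe_mul', ← coe_smul, smul_mul_assoc]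

instance [SMulCommClass ℂ Q Q] : SMulCommClass ℂ p.Compl p.Compl where
  smul_comm c a b := by
    rw [smul_eq_mul, smul_eq_mul]
    induction a, b using induction_on₂ with
    | hp =>
      exact isClosed_eq ((continuous_fst.mul continuous_snd).const_smul c)
        (continuous_fst.mul (continuous_snd.const_smul c))
    | ih a b => rw [← coe_smul, ← coe_mul', ← coe_mul', ← coe_smul, mul_smul_comm]

instance [StarModule ℂ Q] : StarModule ℂ p.Compl where
  star_smul c a := by
    induction a using induction_on with
    | hp =>
      exact isClosed_eq (continuous_id.const_smul c).star
        (continuous_star.const_smul (star c))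
    | ih a => rw [← coe_smul, ← coe_star', ← coe_star', ← coe_smul, star_smul]

noncomputable instance [IsScalarTower ℂ Q Q] [SMulCommClass ℂ Q Q] [StarModule ℂ Q] :
    NonUnitalCStarAlgebra p.Compl where

/-- The canonical *-homomorphism from `Q` to its completion. -/
noncomputable def toComplHom [IsScalarTower ℂ Q Q] [SMulCommClass ℂ Q Q] [StarModule ℂ Q] :
    Q →⋆ₙₐ[ℂ] p.Compl where
  toFun x := ((p.toCarrier x : p.Carrier) : p.Compl)
  map_smul' c x := coe_smul c (p.toCarrier x)
  map_zero' := coe_zero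
  map_add' x y := coe_add (p.toCarrier x) (p.toCarrier y)
  map_mul' x y := coe_mul' p (p.toCarrier x) (p.toCarrier y)
  map_star' x := coe_star' p (p.toCarrier x)

theorem norm_toComplHom [IsScalarTower ℂ Q Q] [SMulCommClass ℂ Q Q] [StarModule ℂ Q] (x : Q) : ‖p.toComplHom x‖ = p.toSeminorm x :=
  norm_coe (p.toCarrier x)

/-- The identity of `Q`, as a map between two seminormed copies of `Q`. -/
def changeSeminorm (p q : CStarSeminorm Q) : p.Carrier →ₗ[ℂ] q.Carrier :=
  (LinearMap.id : Q →ₗ[ℂ] Q)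

/-- If `q ≤ p`, the identity of `Q` extends to a *-homomorphism between the completions. -/
noncomputable def mapCompl [IsScalarTower ℂ Q Q] [SMulCommClass ℂ Q Q] [StarModule ℂ Q]
    (p q : CStarSeminorm Q) (h : ∀ x, q.toSeminorm x ≤ p.toSeminorm x) :
    p.Compl →⋆ₙₐ[ℂ] q.Compl :=
  have huc : UniformContinuous (changeSeminorm p q) :=
    (LipschitzWith.of_dist_le_mul (K := 1) fun x y => by
      rw [dist_eq_norm, dist_eq_norm, NNReal.coe_one, one_mul]
      exact h (x - y)).uniformContinuous
  have hc : Continuous (Completion.map (changeSeminorm p q)) := continuous_map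
  { toFun := Completion.map (changeSeminorm p q)
    map_smul' c a := by
      simp only [MonoidHom.id_apply]
      induction a using induction_on with
      | hp => exact isClosed_eq (hc.comp (continuous_const_smul c)) (hc.const_smul c)
      | ih a => rw [← coe_smul, map_coe huc, map_coe huc, map_smul, coe_smul]
    map_zero' := by rw [← coe_zero, map_coe huc, map_zero, coe_zero]
    map_add' a b := by
      induction a, b using induction_on₂ with
      | hp =>
        exact isClosed_eq (hc.comp continuous_add)
          ((hc.comp continuous_fst).add (hc.comp continuous_snd))
      | ih a b => rw [← coe_add, map_coe huc, map_coe huc, map_coe huc, map_add, coe_add]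
    map_mul' a b := by
      induction a, b using induction_on₂ with
      | hp =>
        exact isClosed_eq (hc.comp continuous_mul)
          ((hc.comp continuous_fst).mul (hc.comp continuous_snd))
      | ih a b =>
        rw [← coe_mul', map_coe huc, map_coe huc, map_coe huc, ← coe_mul']
        rfl
    map_star' a := by
      induction a using induction_on with
      | hp => exact isClosed_eq (hc.comp continuous_star) hc.star
      | ih a =>
        rw [← coe_star', map_coe huc, map_coe huc, ← coe_star']
        rfl }

theorem mapCompl_toComplHom [IsScalarTower ℂ Q Q] [SMulCommClass ℂ Q Q] [StarModule ℂ Q]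
    (p q : CStarSeminorm Q) (h : ∀ x, q.toSeminorm x ≤ p.toSeminorm x) (x : Q) :
    mapCompl p q h (p.toComplHom x) = q.toComplHom x := by
  have huc : UniformContinuous (changeSeminorm p q) :=
    (LipschitzWith.of_dist_le_mul (K := 1) fun x y => by
      rw [dist_eq_norm, dist_eq_norm, NNReal.coe_one, one_mul]
      exact h (x - y)).uniformContinuous
  exact map_coe huc (p.toCarrier x)

end CStarSeminorm

/-- A C*-seminorm on a C*-algebra is dominated by the norm. -/
theorem CStarSeminorm.le_norm {A : Type v} [NonUnitalCStarAlgebra A] (p : CStarSeminorm A) (a : A) :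
    p.toSeminorm a ≤ ‖a‖ := by
  rw [← p.norm_toComplHom]
  exact NonUnitalStarAlgHom.norm_apply_le p.toComplHom a

namespace FellBundle

variable {S : Type u} [InverseMonoid S] (𝒜 : FellBundle.{u, v} S)

/-! ### The unit fibre -/

/-- Multiplication in the unit fibre `A_1`. -/
noncomputable instance : Mul (𝒜.fiber 1) :=
  ⟨fun a b => 𝒜.incl (le_of_eq' (mul_one 1)) (𝒜.mul a b)⟩

/-- Involution in the unit fibre `A_1`. -/
noncomputable instance : Star (𝒜.fiber 1) := ⟨fun a => 𝒜.incl (le_of_eq' one_inv') (𝒜.adj a)⟩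

theorem unit_mul_def (a b : 𝒜.fiber 1) :
    a * b = 𝒜.incl (le_of_eq' (mul_one 1)) (𝒜.mul a b) := rfl

theorem unit_star_def (a : 𝒜.fiber 1) : star a = 𝒜.incl (le_of_eq' one_inv') (𝒜.adj a) := rfl

noncomputable instance : NonUnitalNormedRing (𝒜.fiber 1) where
  __ := 𝒜.normedAddCommGroup 1
  left_distrib a b c := by simp only [unit_mul_def, map_add]
  right_distrib a b c := by simp only [unit_mul_def, map_add, LinearMap.add_apply]
  zero_mul a := by simp only [unit_mul_def, map_zero, LinearMap.zero_apply]
  mul_zero a := by simp only [unit_mul_def, map_zero]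
  mul_assoc a b c := by
    simp only [unit_mul_def]
    have h1 := 𝒜.incl_mul (le_of_eq' (mul_one (1 : S))) (le_refl' 1) (𝒜.mul a b) c
    have h2 := 𝒜.incl_mul (le_refl' (1 : S)) (le_of_eq' (mul_one (1 : S))) a (𝒜.mul b c)
    rw [𝒜.incl_refl] at h1 h2
    rw [← h1, ← h2, ← 𝒜.mul_assoc' a b c]
    rw [𝒜.incl_trans _ _ (le_of_eq' (by simp)), 𝒜.incl_trans _ _ (le_of_eq' (by simp)),
      𝒜.incl_trans _ _ (le_of_eq' (by simp))]
  dist_eq := (𝒜.normedAddCommGroup 1).dist_eq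
  norm_mul_le a b := by
    rw [unit_mul_def, LinearIsometry.norm_map]
    exact 𝒜.norm_mul_le' a b

noncomputable instance : StarRing (𝒜.fiber 1) where
  star_involutive a := by
    simp only [unit_star_def]
    rw [← 𝒜.incl_adj, 𝒜.incl_trans _ _ (le_of_eq' (inv_inv' 1)), 𝒜.adj_adj]
  star_add a b := by simp only [unit_star_def, map_add]
  star_mul a b := by
    simp only [unit_star_def, unit_mul_def]
    rw [← 𝒜.incl_adj, ← 𝒜.incl_mul, ← 𝒜.adj_mul,
      𝒜.incl_trans _ _ (le_of_eq' (by rw [mul_one, one_inv'])),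
      𝒜.incl_trans _ _ (le_of_eq' (by rw [one_inv', mul_one])),
      𝒜.incl_trans _ _ (le_of_eq' (by rw [mul_one, one_inv']))]

theorem norm_unit_star_mul_self (a : 𝒜.fiber 1) : ‖star a * a‖ = ‖a‖ ^ 2 := by
  rw [unit_mul_def, unit_star_def, LinearIsometry.norm_map, ← 𝒜.norm_adj_mul_self a]
  have h := 𝒜.incl_mul (le_of_eq' (one_inv' (S := S))) (le_refl' 1) (𝒜.adj a) a
  rw [𝒜.incl_refl] at h
  rw [← h, LinearIsometry.norm_map]

/-- The unit fibre is a C*-algebra. -/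
noncomputable instance : NonUnitalCStarAlgebra (𝒜.fiber 1) where
  complete := (𝒜.completeSpace 1).complete
  norm_mul_self_le a := by rw [norm_unit_star_mul_self, sq]
  norm_smul_le c a := (norm_smul c a).le
  smul_assoc c a b := by
    simp only [smul_eq_mul, unit_mul_def, map_smul, LinearMap.smul_apply]
  smul_comm c a b := by simp only [smul_eq_mul, unit_mul_def, map_smul]
  star_smul c a := by
    simp only [unit_star_def, LinearMap.map_smulₛₗ, map_smul]
    rfl

/-! ### Finitely supported sections -/

/-- The *-algebra `C_c(𝒜)` of finitely supported sections, i.e. the algebraic direct sum of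
the fibres. -/
def Cc : Type (max u v) := DirectSum S 𝒜.fiber

noncomputable instance : AddCommGroup 𝒜.Cc := inferInstanceAs (AddCommGroup (DirectSum S 𝒜.fiber))
noncomputable instance : Module ℂ 𝒜.Cc := inferInstanceAs (Module ℂ (DirectSum S 𝒜.fiber))

open Classical in
/-- The section `a δ_s` with value `a` at `s` and zero elsewhere. -/
noncomputable def single (s : S) : 𝒜.fiber s →ₗ[ℂ] 𝒜.Cc := DirectSum.lof ℂ S 𝒜.fiber s

variable {N : Type w} [AddCommGroup N] [Module ℂ N]

open Classical in
/-- Linear maps out of `C_c(𝒜)` are given by families of linear maps on the fibres. -/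
noncomputable def lift (φ : ∀ s, 𝒜.fiber s →ₗ[ℂ] N) : 𝒜.Cc →ₗ[ℂ] N :=
  DirectSum.toModule ℂ S N φ

@[simp]
theorem lift_single (φ : ∀ s, 𝒜.fiber s →ₗ[ℂ] N) (s : S) (a : 𝒜.fiber s) :
    𝒜.lift φ (𝒜.single s a) = φ s a := by
  classical
  exact DirectSum.toModule_lof ℂ s a

theorem Cc.induction {motive : 𝒜.Cc → Prop} (zero : motive 0)
    (single : ∀ s a, motive (𝒜.single s a)) (add : ∀ x y, motive x → motive y → motive (x + y))
    (x : 𝒜.Cc) : motive x := by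
  classical
  exact DirectSum.induction_on (motive := motive) x zero single add

theorem single_incl_eq {s t : S} (h : s = t) (hle : s ≤ t) (a : 𝒜.fiber s) :
    𝒜.single t (𝒜.incl hle a) = 𝒜.single s a := by
  subst h
  rw [𝒜.incl_refl]

/-- The bilinear multiplication `(a δ_s) (b δ_t) = (a b) δ_{st}` of `C_c(𝒜)`. -/
noncomputable def mulHom : 𝒜.Cc →ₗ[ℂ] 𝒜.Cc →ₗ[ℂ] 𝒜.Cc :=
  𝒜.lift fun s => LinearMap.flip <| 𝒜.lift fun t =>
    (LinearMap.compr₂ (𝒜.mul (s := s) (t := t)) (𝒜.single (s * t))).flip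

noncomputable instance : Mul 𝒜.Cc := ⟨fun x y => 𝒜.mulHom x y⟩

theorem mul_def (x y : 𝒜.Cc) : x * y = 𝒜.mulHom x y := rfl

theorem single_mul_single {s t : S} (a : 𝒜.fiber s) (b : 𝒜.fiber t) :
    𝒜.single s a * 𝒜.single t b = 𝒜.single (s * t) (𝒜.mul a b) := by
  simp [mul_def, mulHom]

noncomputable instance : NonUnitalRing 𝒜.Cc where
  left_distrib x y z := by simp only [mul_def, map_add]
  right_distrib x y z := by simp only [mul_def, map_add, LinearMap.add_apply]
  zero_mul x := by simp only [mul_def, map_zero, LinearMap.zero_apply]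
  mul_zero x := by simp only [mul_def, map_zero]
  mul_assoc x y z := by
    induction x using Cc.induction with
    | zero => simp only [mul_def, map_zero, LinearMap.zero_apply]
    | add x x' hx hx' =>
      simp only [mul_def, map_add, LinearMap.add_apply] at hx hx' ⊢
      rw [hx, hx']
    | single r a =>
      induction y using Cc.induction with
      | zero => simp only [mul_def, map_zero, LinearMap.zero_apply]
      | add x x' hx hx' =>
        simp only [mul_def, map_add, LinearMap.add_apply] at hx hx' ⊢
        rw [hx, hx']
      | single s b =>
        induction z using Cc.induction with
        | zero => simp only [mul_def, map_zero]
        | add x x' hx hx' =>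
          simp only [mul_def, map_add] at hx hx' ⊢
          rw [hx, hx']
        | single t c =>
          rw [single_mul_single, single_mul_single, single_mul_single, single_mul_single,
            ← 𝒜.mul_assoc', single_incl_eq _ (mul_assoc r s t)]

instance : IsScalarTower ℂ 𝒜.Cc 𝒜.Cc where
  smul_assoc c x y := by simp only [smul_eq_mul, mul_def, map_smul, LinearMap.smul_apply]

instance : SMulCommClass ℂ 𝒜.Cc 𝒜.Cc where
  smul_comm c x y := by simp only [smul_eq_mul, mul_def, map_smul]

open Classical in
/-- The involution `(a δ_s)^* = a^* δ_{s^*}` of `C_c(𝒜)`. -/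
noncomputable def starHom : 𝒜.Cc →+ 𝒜.Cc :=
  DirectSum.toAddMonoid fun s =>
    (𝒜.single s⁻¹).toAddMonoidHom.comp (𝒜.adj (s := s)).toAddMonoidHom

noncomputable instance : Star 𝒜.Cc := ⟨fun x => 𝒜.starHom x⟩

theorem star_def (x : 𝒜.Cc) : star x = 𝒜.starHom x := rfl

theorem star_single {s : S} (a : 𝒜.fiber s) : star (𝒜.single s a) = 𝒜.single s⁻¹ (𝒜.adj a) := by
  classical
  exact DirectSum.toAddMonoid_of (β := 𝒜.fiber) _ s a

noncomputable instance : StarRing 𝒜.Cc where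
  star_involutive x := by
    induction x using Cc.induction with
    | zero => simp only [star_def, map_zero]
    | add x y hx hy =>
      simp only [star_def, map_add] at hx hy ⊢
      rw [hx, hy]
    | single s a =>
      rw [star_single, star_single]
      conv_rhs => rw [← 𝒜.adj_adj a, single_incl_eq _ (inv_inv' s)]
  star_add x y := by simp only [star_def, map_add]
  star_mul x y := by
    induction x using Cc.induction with
    | zero => simp only [zero_mul, star_def, map_zero, mul_zero]
    | add x x' hx hx' =>
      rw [add_mul]
      simp only [star_def, map_add, mul_add] at hx hx' ⊢
      rw [hx, hx']
    | single s a =>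
      induction y using Cc.induction with
      | zero => simp only [zero_mul, star_def, map_zero, mul_zero]
      | add x x' hx hx' =>
        rw [mul_add]
        simp only [star_def, map_add, add_mul] at hx hx' ⊢
        rw [hx, hx']
      | single t b =>
        rw [single_mul_single, star_single, star_single, star_single, single_mul_single,
          ← 𝒜.adj_mul, single_incl_eq _ (mul_inv_rev' s t)]

instance : StarModule ℂ 𝒜.Cc where
  star_smul c x := by
    induction x using Cc.induction with
    | zero => simp only [smul_zero, star_def, map_zero]
    | add x y hx hy =>
      rw [smul_add, star_add, star_add, smul_add, hx, hy]
    | single s a =>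
      rw [← map_smul, star_single, star_single, LinearMap.map_smulₛₗ, map_smul]
      rfl

/-! ### The full cross-sectional C*-algebra -/

/-- A C*-seminorm on `C_c(𝒜)` is admissible if it vanishes on the differences `a δ_s - a δ_t`,
`a ∈ A_s ⊆ A_t`, `s ≤ t`. It then vanishes on the *-ideal generated by them, so the admissible
C*-seminorms are those of the quotient *-algebra of `C_c(𝒜)` by this ideal. -/
def Admissible (p : CStarSeminorm 𝒜.Cc) : Prop :=
  ∀ (s t : S) (h : s ≤ t) (a : 𝒜.fiber s),
    p.toSeminorm (𝒜.single s a - 𝒜.single t (𝒜.incl h a)) = 0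

variable {𝒜}

theorem Admissible.eq_of_le {p : CStarSeminorm 𝒜.Cc} (hp : 𝒜.Admissible p) {s t : S} (h : s ≤ t)
    (a : 𝒜.fiber s) :
    p.toSeminorm (𝒜.single t (𝒜.incl h a)) = p.toSeminorm (𝒜.single s a) := by
  have h0 := hp s t h a
  have h1 := abs_sub_map_le_sub p.toSeminorm (𝒜.single s a) (𝒜.single t (𝒜.incl h a))
  rw [h0] at h1
  have := abs_eq_zero.mp (le_antisymm h1 (abs_nonneg _))
  linarith

theorem Admissible.single_le {p : CStarSeminorm 𝒜.Cc} (hp : 𝒜.Admissible p) {s : S}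
    (a : 𝒜.fiber s) : p.toSeminorm (𝒜.single s a) ≤ ‖a‖ := by
  let q : CStarSeminorm (𝒜.fiber 1) :=
    { toSeminorm := p.toSeminorm.comp (𝒜.single 1)
      mul_le' := fun x y => by
        have h : 𝒜.single 1 (x * y) = 𝒜.single 1 x * 𝒜.single 1 y := by
          rw [unit_mul_def, single_incl_eq _ (mul_one 1), single_mul_single]
        change p.toSeminorm (𝒜.single 1 (x * y)) ≤ _
        rw [h]
        exact p.mul_le' _ _
      star_mul_self' := fun x => by
        have h : 𝒜.single 1 (star x * x) = star (𝒜.single 1 x) * 𝒜.single 1 x := by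
          rw [unit_mul_def, single_incl_eq _ (mul_one 1), ← single_mul_single, star_single,
            unit_star_def, single_incl_eq _ one_inv']
        change p.toSeminorm (𝒜.single 1 (star x * x)) = _
        rw [h]
        exact p.star_mul_self' _ }
  have h1 : p.toSeminorm (𝒜.single s a) ^ 2 ≤ ‖a‖ ^ 2 := by
    have h2 : p.toSeminorm (star (𝒜.single s a) * 𝒜.single s a) = p.toSeminorm (𝒜.single s a) ^ 2 :=
      p.star_mul_self' _
    rw [← h2, star_single, single_mul_single, ← hp.eq_of_le (inv_mul_le_one s)]
    refine (q.le_norm _).trans ?_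
    rw [LinearIsometry.norm_map, 𝒜.norm_adj_mul_self]
  exact le_of_sq_le_sq h1 (norm_nonneg a)

variable (𝒜)

theorem admissible_bddAbove (x : 𝒜.Cc) :
    BddAbove (Set.range fun p : {p : CStarSeminorm 𝒜.Cc // 𝒜.Admissible p} =>
      p.1.toSeminorm x) := by
  suffices h : ∃ C, ∀ p : {p : CStarSeminorm 𝒜.Cc // 𝒜.Admissible p}, p.1.toSeminorm x ≤ C by
    obtain ⟨C, hC⟩ := h
    exact ⟨C, by rintro _ ⟨p, rfl⟩; exact hC p⟩
  induction x using Cc.induction with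
  | zero => exact ⟨0, fun p => (map_zero p.1.toSeminorm).le⟩
  | single s a => exact ⟨‖a‖, fun p => p.2.single_le a⟩
  | add x y hx hy =>
    obtain ⟨C, hC⟩ := hx
    obtain ⟨D, hD⟩ := hy
    exact ⟨C + D, fun p => (map_add_le_add p.1.toSeminorm x y).trans (add_le_add (hC p) (hD p))⟩

instance : Nonempty {p : CStarSeminorm 𝒜.Cc // 𝒜.Admissible p} :=
  ⟨⟨CStarSeminorm.ofLe 0 (fun x y => by simp) (fun x => by simp), fun _ _ _ _ => rfl⟩⟩

/-- The largest admissible C*-seminorm on `C_c(𝒜)`. -/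
noncomputable def maxSeminorm : CStarSeminorm 𝒜.Cc :=
  CStarSeminorm.ofLe
    { toFun := fun x => ⨆ p : {p : CStarSeminorm 𝒜.Cc // 𝒜.Admissible p}, p.1.toSeminorm x
      map_zero' := by simp
      add_le' := fun x y => ciSup_le fun p =>
        (map_add_le_add p.1.toSeminorm x y).trans
          (add_le_add (le_ciSup (𝒜.admissible_bddAbove x) p) (le_ciSup (𝒜.admissible_bddAbove y) p))
      neg' := fun x => by simp
      smul' := fun c x => by
        simp only [map_smul_eq_mul]
        rw [Real.mul_iSup_of_nonneg (norm_nonneg c)] }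
    (fun x y => ciSup_le fun p => (p.1.mul_le' x y).trans
      (mul_le_mul (le_ciSup (𝒜.admissible_bddAbove x) p) (le_ciSup (𝒜.admissible_bddAbove y) p)
        (apply_nonneg p.1.toSeminorm y)
        (Real.iSup_nonneg fun q => apply_nonneg q.1.toSeminorm x)))
    (fun x => by
      have h0 : 0 ≤ ⨆ p : {p : CStarSeminorm 𝒜.Cc // 𝒜.Admissible p},
          p.1.toSeminorm (star x * x) := Real.iSup_nonneg fun q => apply_nonneg q.1.toSeminorm _
      have h1 : 0 ≤ ⨆ p : {p : CStarSeminorm 𝒜.Cc // 𝒜.Admissible p}, p.1.toSeminorm x :=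
        Real.iSup_nonneg fun q => apply_nonneg q.1.toSeminorm x
      refine (Real.le_sqrt h1 h0).mp ?_
      refine ciSup_le fun p => Real.le_sqrt_of_sq_le ?_
      exact (p.1.star_mul_self' x).symm.le.trans (le_ciSup (𝒜.admissible_bddAbove (star x * x)) p))

theorem le_maxSeminorm (p : CStarSeminorm 𝒜.Cc) (hp : 𝒜.Admissible p) (x : 𝒜.Cc) :
    p.toSeminorm x ≤ 𝒜.maxSeminorm.toSeminorm x :=
  le_ciSup (𝒜.admissible_bddAbove x) ⟨p, hp⟩

theorem maxSeminorm_admissible : 𝒜.Admissible 𝒜.maxSeminorm := fun s t h a =>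
  le_antisymm (ciSup_le fun p => (p.2 s t h a).le) (apply_nonneg 𝒜.maxSeminorm.toSeminorm _)

/-- The full (maximal) cross-sectional C*-algebra `C^*(𝒜)`: the enveloping C*-algebra of the
quotient of `C_c(𝒜)` by the relations `a δ_s = a δ_t`, `a ∈ A_s ⊆ A_t`, `s ≤ t`. -/
abbrev FullAlg : Type (max u v) := 𝒜.maxSeminorm.Compl

end FellBundle

/-! ### Direct sums of representations -/

section DirectSumRep

variable {ι : Type u} {G : ι → Type v} [∀ i, NormedAddCommGroup (G i)]
  [∀ i, InnerProductSpace ℂ (G i)] {B : Type w} [NonUnitalCStarAlgebra B]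

/-- A bounded family of operators acts diagonally on the Hilbert space direct sum. -/
noncomputable def lpDiag (T : ∀ i, G i →L[ℂ] G i) (C : ℝ) (hC : ∀ i, ‖T i‖ ≤ C) :
    lp G 2 →L[ℂ] lp G 2 :=
  have hb : ∀ (x : lp G 2) (i : ι), ‖T i (x i)‖ ≤ ‖(((|C| : ℝ) : ℂ) • x) i‖ := fun x i => by
    rw [lp.coeFn_smul, Pi.smul_apply, norm_smul, Complex.norm_real, Real.norm_eq_abs, abs_abs]
    exact ((T i).le_opNorm _).trans
      (mul_le_mul_of_nonneg_right ((hC i).trans (le_abs_self C)) (norm_nonneg _))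
  LinearMap.mkContinuous
    { toFun := fun x => ⟨fun i => T i (x i), (lp.memℓp (((|C| : ℝ) : ℂ) • x)).mono' (hb x)⟩
      map_add' := fun x y => by ext i; exact map_add (T i) (x i) (y i)
      map_smul' := fun c x => by ext i; exact map_smul (T i) c (x i) }
    |C| fun x => by
      refine (lp.norm_mono (y := ((|C| : ℝ) : ℂ) • x) two_ne_zero (hb x)).trans ?_
      rw [norm_smul, Complex.norm_real, Real.norm_eq_abs, abs_abs]

@[simp]
theorem lpDiag_apply (T : ∀ i, G i →L[ℂ] G i) (C : ℝ) (hC : ∀ i, ‖T i‖ ≤ C) (x : lp G 2) (i : ι) :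
    lpDiag T C hC x i = T i (x i) := rfl

variable [∀ i, CompleteSpace (G i)]

/-- The direct sum of a family of *-representations of a C*-algebra. -/
noncomputable def directSumRep (ρ : ∀ i, B →⋆ₙₐ[ℂ] (G i →L[ℂ] G i)) :
    B →⋆ₙₐ[ℂ] (lp G 2 →L[ℂ] lp G 2) where
  toFun b := lpDiag (fun i => ρ i b) ‖b‖ fun i => NonUnitalStarAlgHom.norm_apply_le (ρ i) b
  map_smul' c b := by ext x i; simp
  map_zero' := by ext x i; simp
  map_add' b c := by ext x i; simp
  map_mul' b c := by ext x i; simp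
  map_star' b := by
    refine (ContinuousLinearMap.eq_adjoint_iff _ _).mpr fun x y => ?_
    simp only [lp.inner_eq_tsum, lpDiag_apply]
    refine tsum_congr fun i => ?_
    rw [map_star, ContinuousLinearMap.star_eq_adjoint, ContinuousLinearMap.adjoint_inner_left]

end DirectSumRep

namespace FellBundle

variable {S : Type u} [InverseMonoid S] (𝒜 : FellBundle.{u, v} S)

/-- A representation of the Fell bundle `𝒜` on the Hilbert space `H`. -/
structure Rep (H : Type w) [NormedAddCommGroup H] [InnerProductSpace ℂ H] [CompleteSpace H] where
  /-- the linear maps `π_s : A_s → B(H)` -/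
  op : ∀ s : S, 𝒜.fiber s →ₗ[ℂ] (H →L[ℂ] H)
  op_mul : ∀ {s t : S} (a : 𝒜.fiber s) (b : 𝒜.fiber t), op s a * op t b = op (s * t) (𝒜.mul a b)
  op_adj : ∀ {s : S} (a : 𝒜.fiber s), star (op s a) = op s⁻¹ (𝒜.adj a)
  op_incl : ∀ {s t : S} (h : s ≤ t) (a : 𝒜.fiber s), op t (𝒜.incl h a) = op s a

open scoped ComplexOrder

noncomputable instance : PartialOrder 𝒜.FullAlg := CStarAlgebra.spectralOrder _

instance : StarOrderedRing 𝒜.FullAlg := CStarAlgebra.spectralOrderedRing _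

/-- The Hilbert space of the universal representation of `C^*(𝒜)`: the direct sum of the GNS
spaces of all positive linear functionals. -/
abbrev UnivSpace : Type (max u v) := lp (fun f : 𝒜.FullAlg →ₚ[ℂ] ℂ => f.GNS) 2

/-- The universal representation of `C^*(𝒜)`. -/
noncomputable def univHom : 𝒜.FullAlg →⋆ₙₐ[ℂ] (𝒜.UnivSpace →L[ℂ] 𝒜.UnivSpace) :=
  directSumRep fun f => f.gnsNonUnitalStarAlgHom

theorem toComplHom_incl {s t : S} (h : s ≤ t) (a : 𝒜.fiber s) :
    𝒜.maxSeminorm.toComplHom (𝒜.single t (𝒜.incl h a)) =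
      𝒜.maxSeminorm.toComplHom (𝒜.single s a) := by
  symm
  rw [← sub_eq_zero, ← map_sub, ← norm_eq_zero, CStarSeminorm.norm_toComplHom]
  exact 𝒜.maxSeminorm_admissible s t h a

/-- The universal representation of the Fell bundle `𝒜`, i.e. the restriction of the universal
representation of `C^*(𝒜)` to the fibres. -/
noncomputable def univRep : 𝒜.Rep 𝒜.UnivSpace where
  op s :=
    { toFun := fun a => 𝒜.univHom (𝒜.maxSeminorm.toComplHom (𝒜.single s a))
      map_add' := fun a b => by simp only [map_add]
      map_smul' := fun c a => by simp only [map_smul, RingHom.id_apply] }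
  op_mul a b := by
    simp only [LinearMap.coe_mk, AddHom.coe_mk]
    rw [← map_mul, ← map_mul, single_mul_single]
  op_adj a := by
    simp only [LinearMap.coe_mk, AddHom.coe_mk]
    rw [← map_star, ← map_star, star_single]
  op_incl h a := by
    simp only [LinearMap.coe_mk, AddHom.coe_mk]
    rw [toComplHom_incl]

end FellBundle

namespace FellBundle

variable {S : Type u} [InverseMonoid S] (𝒜 : FellBundle.{u, v} S)

/-! ### The ideals `I_{s,t}` and the projections `1_{s,t}` -/

/-- The closed ideal `I_{s,t}` of `A_1` generated by the `A_{v^* v}` with `v ≤ s, t`. As every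
`A_e` with `e` idempotent is an ideal of `A_1`, it is the closed linear span of the
`A_{v^* v}`. -/
noncomputable def ideal (s t : S) : Submodule ℂ (𝒜.fiber 1) :=
  (⨆ v : {v : S // v ≤ s ∧ v ≤ t},
    LinearMap.range (𝒜.incl (inv_mul_le_one v.1)).toLinearMap).topologicalClosure

variable {𝒜}

namespace Rep

variable {H : Type w} [NormedAddCommGroup H] [InnerProductSpace ℂ H] [CompleteSpace H]
  (π : 𝒜.Rep H)

/-- The restriction of a representation to the unit fibre. -/
noncomputable def unitHom : 𝒜.fiber 1 →⋆ₙₐ[ℂ] (H →L[ℂ] H) where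
  toFun := π.op 1
  map_smul' c a := map_smul (π.op 1) c a
  map_zero' := map_zero _
  map_add' := map_add _
  map_mul' a b := by rw [unit_mul_def, π.op_incl, π.op_mul]
  map_star' a := by rw [unit_star_def, π.op_incl, π.op_adj]

theorem continuous_op_one : Continuous (π.op 1) :=
  AddMonoidHomClass.continuous_of_bound π.unitHom 1 fun a => by
    rw [one_mul]
    exact NonUnitalStarAlgHom.norm_apply_le π.unitHom a

theorem op_op_apply {s t : S} (a : 𝒜.fiber s) (b : 𝒜.fiber t) (x : H) :
    π.op s a (π.op t b x) = π.op (s * t) (𝒜.mul a b) x := by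
  rw [← π.op_mul]
  rfl

/-- The closed linear span of `π(I_{s,t}) H`. -/
def unitSpace (s t : S) : Submodule ℂ H :=
  (Submodule.span ℂ {y : H | ∃ a ∈ 𝒜.ideal s t, ∃ h : H, π.op 1 a h = y}).topologicalClosure

instance (s t : S) : CompleteSpace (π.unitSpace s t) :=
  inferInstanceAs (CompleteSpace (Submodule.topologicalClosure _))

/-- The projection `1_{s,t}`: the unit of the weak closure `I_{s,t}''` of `π(I_{s,t})`, that is,
the orthogonal projection onto the closed linear span of `π(I_{s,t}) H`. -/
noncomputable def unitProj (s t : S) : H →L[ℂ] H := (π.unitSpace s t).starProjection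

/-- The projection `1_s = 1_{s,1}`. -/
noncomputable def one (s : S) : H →L[ℂ] H := π.unitProj s 1

theorem isClosed_unitSpace (s t : S) : IsClosed (π.unitSpace s t : Set H) :=
  Submodule.isClosed_topologicalClosure _

theorem mem_unitSpace {e s : S} (he : e * e = e) (h : e ≤ s) (a : 𝒜.fiber e) (x : H) :
    π.op e a x ∈ π.unitSpace s 1 := by
  have h1 : e ≤ e⁻¹ * e := le_of_eq' (by rw [inv_of_idem he, he])
  refine Submodule.le_topologicalClosure _ (Submodule.subset_span ?_)
  refine ⟨𝒜.incl (idem_le_one he) a, ?_, x, by rw [π.op_incl]⟩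
  refine Submodule.le_topologicalClosure _ ?_
  refine Submodule.mem_iSup_of_mem ⟨e, h, idem_le_one he⟩ ⟨𝒜.incl h1 a, ?_⟩
  exact 𝒜.incl_trans h1 _ _ a

theorem unitSpace_le {s : S} {M : Submodule ℂ H} (hM : IsClosed (M : Set H))
    (h : ∀ e : S, e * e = e → e ≤ s → ∀ (a : 𝒜.fiber e) (x : H), π.op e a x ∈ M) :
    π.unitSpace s 1 ≤ M := by
  refine Submodule.topologicalClosure_minimal _ (Submodule.span_le.mpr ?_) hM
  rintro _ ⟨a, ha, x, rfl⟩
  let L : 𝒜.fiber 1 →ₗ[ℂ] H := (ContinuousLinearMap.apply ℂ H x).toLinearMap ∘ₗ π.op 1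
  have hL : Continuous L :=
    (ContinuousLinearMap.apply ℂ H x).continuous.comp π.continuous_op_one
  suffices h' : 𝒜.ideal s 1 ≤ M.comap L from h' ha
  refine Submodule.topologicalClosure_minimal _ (iSup_le ?_) (hM.preimage hL)
  rintro ⟨v, hv, hv1⟩ _ ⟨b, rfl⟩
  have hvv : v⁻¹ * v = v := by
    rw [inv_of_idem (idem_of_le_one hv1), idem_of_le_one hv1]
  change π.op 1 (𝒜.incl (inv_mul_le_one v) b) x ∈ M
  rw [π.op_incl]
  exact h _ (idem_inv_mul v) (le_trans' (le_of_eq' hvv) hv) b x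

theorem map_unitSpace {s : S} {M : Submodule ℂ H} (hM : IsClosed (M : Set H)) (T : H →L[ℂ] H)
    (h : ∀ e : S, e * e = e → e ≤ s → ∀ (a : 𝒜.fiber e) (x : H), T (π.op e a x) ∈ M)
    {x : H} (hx : x ∈ π.unitSpace s 1) : T x ∈ M := by
  have h' : π.unitSpace s 1 ≤ M.comap T.toLinearMap :=
    π.unitSpace_le (hM.preimage T.continuous) h
  exact h' hx

theorem unitSpace_mono {s t : S} (h : s ≤ t) : π.unitSpace s 1 ≤ π.unitSpace t 1 :=
  π.unitSpace_le (π.isClosed_unitSpace t 1) fun _ he hes a x =>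
    π.mem_unitSpace he (le_trans' hes h) a x

/-- The range of `π_r(c)` lies in every closed subspace that contains `π(A_{r r^*}) H`. -/
theorem range_mem {r : S} {M : Submodule ℂ H} (hM : IsClosed (M : Set H))
    (h : ∀ (b : 𝒜.fiber (r * r⁻¹)) (x : H), π.op (r * r⁻¹) b x ∈ M) (c : 𝒜.fiber r) (x : H) :
    π.op r c x ∈ M := by
  have : CompleteSpace M := hM.completeSpace_coe
  rw [← Submodule.orthogonal_orthogonal M, Submodule.mem_orthogonal]
  intro y hy
  have h1 : star (π.op r c) y = 0 := by
    rw [← inner_self_eq_zero (𝕜 := ℂ)]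
    nth_rewrite 1 [ContinuousLinearMap.star_eq_adjoint]
    rw [ContinuousLinearMap.adjoint_inner_left, π.op_adj, π.op_op_apply]
    exact inner_eq_zero_symm.mp (Submodule.mem_orthogonal M y |>.mp hy _ (h _ y))
  rw [← ContinuousLinearMap.adjoint_inner_left, ← ContinuousLinearMap.star_eq_adjoint, h1,
    inner_zero_left]

theorem op_mem_unitSpace {r u : S} (h : r * r⁻¹ ≤ u) (c : 𝒜.fiber r) (x : H) :
    π.op r c x ∈ π.unitSpace u 1 :=
  π.range_mem (π.isClosed_unitSpace u 1)
    (fun b y => π.mem_unitSpace (idem_mul_inv r) h b y) c x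

theorem one_isSymmetric (u : S) (x y : H) :
    inner ℂ (π.one u x) y = inner ℂ x (π.one u y) :=
  Submodule.inner_starProjection_left_eq_right _ x y

theorem star_one (u : S) : star (π.one u) = π.one u := by
  rw [ContinuousLinearMap.star_eq_adjoint]
  exact ((ContinuousLinearMap.eq_adjoint_iff _ _).mpr (π.one_isSymmetric u)).symm

theorem one_apply_mem (u : S) (x : H) : π.one u x ∈ π.unitSpace u 1 :=
  Submodule.starProjection_apply_mem _ x

theorem one_apply_eq {u : S} {x : H} (h : x ∈ π.unitSpace u 1) : π.one u x = x :=
  Submodule.starProjection_eq_self_iff.mpr h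

theorem one_mul_one (u : S) : π.one u * π.one u = π.one u := by
  ext x
  exact π.one_apply_eq (π.one_apply_mem u x)

theorem intertwine {T : H →L[ℂ] H} {u w : S}
    (h₁ : ∀ x ∈ π.unitSpace u 1, T x ∈ π.unitSpace w 1)
    (h₂ : ∀ x ∈ π.unitSpace w 1, star T x ∈ π.unitSpace u 1) : T * π.one u = π.one w * T := by
  have e1 : π.one w * (T * π.one u) = T * π.one u := by
    ext x
    exact π.one_apply_eq (h₁ _ (π.one_apply_mem u x))
  have e2 : π.one u * (star T * π.one w) = star T * π.one w := by
    ext x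
    exact π.one_apply_eq (h₂ _ (π.one_apply_mem w x))
  have e3 := congrArg star e2
  simp only [star_mul, star_star, star_one] at e3
  rw [← e1, ← e3, ← mul_assoc]

theorem op_map_unitSpace {s u w : S} (a : 𝒜.fiber s)
    (h : ∀ e : S, e * e = e → e ≤ u → s * e * s⁻¹ ≤ w) (x : H) (hx : x ∈ π.unitSpace u 1) :
    π.op s a x ∈ π.unitSpace w 1 := by
  refine π.map_unitSpace (π.isClosed_unitSpace w 1) _ (fun e he heu b y => ?_) hx
  rw [op_op_apply]
  refine π.op_mem_unitSpace (le_trans' (le_of_eq' ?_) (h e he heu)) _ y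
  rw [mul_inv_rev', inv_of_idem he]
  calc s * e * (e * s⁻¹) = s * (e * e) * s⁻¹ := by simp only [mul_assoc]
    _ = s * e * s⁻¹ := by rw [he]

theorem op_mul_one_eq {s u w : S} (a : 𝒜.fiber s)
    (h₁ : ∀ e : S, e * e = e → e ≤ u → s * e * s⁻¹ ≤ w)
    (h₂ : ∀ e : S, e * e = e → e ≤ w → s⁻¹ * e * s ≤ u) :
    π.op s a * π.one u = π.one w * π.op s a := by
  refine π.intertwine (π.op_map_unitSpace a h₁) ?_
  rw [π.op_adj]
  refine π.op_map_unitSpace _ ?_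
  simpa only [inv_inv'] using h₂

theorem op_mul_one_conj {s : S} (a : 𝒜.fiber s) (u : S) :
    π.op s a * π.one u = π.one (s * u * s⁻¹) * π.op s a := by
  refine π.op_mul_one_eq a (fun e _ heu => ?_) (fun e _ hew => ?_)
  · exact mul_le_mul'' (mul_le_mul'' (le_refl' s) heu) (le_refl' _)
  · have h1 : s⁻¹ * e * s ≤ s⁻¹ * (s * u * s⁻¹) * s :=
      mul_le_mul'' (mul_le_mul'' (le_refl' _) hew) (le_refl' _)
    have h2 : s⁻¹ * (s * u * s⁻¹) * s = (s⁻¹ * s) * u * (s⁻¹ * s) := by simp only [mul_assoc]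
    rw [h2] at h1
    exact le_trans' h1 (le_trans' (mul_idem_le _ (idem_inv_mul s))
      (idem_mul_le (idem_inv_mul s) u))

theorem op_mul_one_swap {t : S} (a : 𝒜.fiber t) (s : S) :
    π.op t a * π.one (s⁻¹ * t) = π.one (s * t⁻¹) * π.op t a := by
  refine π.op_mul_one_eq a (fun e he hes => ?_) (fun e he hes => ?_)
  · have h1 := le_inv_of_idem_le he hes
    rw [mul_inv_rev', inv_inv'] at h1
    have h2 : t * e * t⁻¹ ≤ t * (t⁻¹ * s) * t⁻¹ :=
      mul_le_mul'' (mul_le_mul'' (le_refl' _) h1) (le_refl' _)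
    have h3 : t * (t⁻¹ * s) * t⁻¹ = (t * t⁻¹) * (s * t⁻¹) := by simp only [mul_assoc]
    rw [h3] at h2
    exact le_trans' h2 (idem_mul_le (idem_mul_inv t) _)
  · have h1 := le_inv_of_idem_le he hes
    rw [mul_inv_rev', inv_inv'] at h1
    have h2 : t⁻¹ * e * t ≤ t⁻¹ * (t * s⁻¹) * t :=
      mul_le_mul'' (mul_le_mul'' (le_refl' _) h1) (le_refl' _)
    have h3 : t⁻¹ * (t * s⁻¹) * t = (t⁻¹ * t) * (s⁻¹ * t) := by simp only [mul_assoc]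
    rw [h3] at h2
    exact le_trans' h2 (idem_mul_le (idem_inv_mul t) _)

theorem op_idem_comm_one {e : S} (he : e * e = e) (b : 𝒜.fiber e) (u : S) :
    π.op e b * π.one u = π.one u * π.op e b := by
  have key : ∀ f : S, f * f = f → f ≤ u → e * f * e ≤ u := fun f hf hfu =>
    le_trans' (le_trans' (mul_idem_le _ he) (idem_mul_le he f)) hfu
  refine π.op_mul_one_eq b (fun f hf hfu => ?_) (fun f hf hfu => ?_)
  · rw [inv_of_idem he]; exact key f hf hfu
  · rw [inv_of_idem he]; exact key f hf hfu

theorem one_op_apply {e : S} (he : e * e = e) (b : 𝒜.fiber e) (u : S) (x : H) :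
    π.one u (π.op e b x) = π.op e b (π.one u x) :=
  (DFunLike.congr_fun (π.op_idem_comm_one he b u) x).symm

theorem one_map_unitSpace (u w : S) (x : H) (hx : x ∈ π.unitSpace u 1) :
    π.one w x ∈ π.unitSpace u 1 := by
  refine π.map_unitSpace (π.isClosed_unitSpace u 1) _ (fun e he heu b y => ?_) hx
  rw [π.one_op_apply he]
  exact π.mem_unitSpace he heu b _

theorem one_comm (u w : S) : π.one u * π.one w = π.one w * π.one u := by
  symm
  refine π.intertwine (π.one_map_unitSpace u w) ?_
  rw [star_one]
  exact π.one_map_unitSpace u w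

theorem one_inv (u : S) : π.one u⁻¹ = π.one u := by
  have key : ∀ s : S, π.unitSpace s 1 ≤ π.unitSpace s⁻¹ 1 := fun s =>
    π.unitSpace_le (π.isClosed_unitSpace s⁻¹ 1) fun e he hes b y =>
      π.mem_unitSpace he (le_inv_of_idem_le he hes) b y
  have : π.unitSpace u⁻¹ 1 = π.unitSpace u 1 :=
    le_antisymm (by simpa only [inv_inv'] using key u⁻¹) (key u)
  simp only [one, unitProj, this]

theorem one_mul_one_mem (u w : S) (x : H) : π.one u (π.one w x) ∈ π.unitSpace (u * w) 1 := by
  refine π.map_unitSpace (π.isClosed_unitSpace (u * w) 1) _ (fun f hf hfw b y => ?_)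
    (π.one_apply_mem w x)
  rw [π.one_op_apply hf]
  refine π.map_unitSpace (π.isClosed_unitSpace (u * w) 1) _ (fun e he heu c z => ?_)
    (π.one_apply_mem u y)
  rw [op_op_apply]
  refine π.mem_unitSpace (idem_mul hf he) ?_ _ z
  rw [idem_comm hf he]
  exact mul_le_mul'' heu hfw

theorem one_mul_eq_of_le {u w : S} (h : u ≤ w) : π.one w * π.one u = π.one u := by
  ext x
  exact π.one_apply_eq (π.unitSpace_mono h (π.one_apply_mem u x))

/-- The projections `1_{s t^*}`. -/
noncomputable def link (s t : S) : H →L[ℂ] H := π.one (s * t⁻¹)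

theorem link_symm (s t : S) : π.link s t = π.link t s := by
  rw [link, ← π.one_inv, mul_inv_rev', inv_inv', link]

theorem link_trans (r s t : S) :
    π.link r t * (π.link r s * π.link s t) = π.link r s * π.link s t := by
  ext x
  refine π.one_apply_eq (π.unitSpace_mono ?_ (π.one_mul_one_mem _ _ x))
  have h : r * s⁻¹ * (s * t⁻¹) = r * (s⁻¹ * s) * t⁻¹ := by simp only [mul_assoc]
  rw [h]
  exact mul_le_mul'' (mul_idem_le r (idem_inv_mul s)) (le_refl' _)

end Rep

end FellBundle

/-! ### A positivity lemma -/

theorem re_sum_inner_nonneg {ι : Type u} {H : Type w} [NormedAddCommGroup H]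
    [InnerProductSpace ℂ H] (q : ι → ι → (H →L[ℂ] H)) (D : H →L[ℂ] H)
    (hsa : ∀ i j x y, inner ℂ (q i j x) y = inner ℂ x (q i j y))
    (hsymm : ∀ i j, q i j = q j i) (hidem : ∀ i j, q i j * q i j = q i j)
    (hcomm : ∀ i j k l, q i j * q k l = q k l * q i j)
    (htrans : ∀ i j k, q i k * (q i j * q j k) = q i j * q j k)
    (hD : ∀ i j, D * q i j = q i j * D) (hpos : ∀ x, 0 ≤ (inner ℂ x (D x)).re)
    (F : Finset ι) (x : ι → H) :
    0 ≤ (∑ i ∈ F, ∑ j ∈ F, inner ℂ (x i) (D (q i j (x j)))).re := by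
  classical
  induction F using Finset.induction generalizing x with
  | empty => simp
  | insert a F ha ih =>
    let x' : ι → H := fun j => x j - q a j (x j)
    have hop : ∀ i j, q i j = q i a * q a j + (1 - q i a) * (q i j * (1 - q a j)) := fun i j => by
      have e1 : q i a * q i j = q i a * q a j * q i j := by
        have h := htrans a i j
        rw [hsymm a i] at h
        rw [← h, ← mul_assoc, hcomm a j i a]
      have e2 : q i a * q a j * q i j = q i a * q a j := by
        have h := htrans i a j
        rw [mul_assoc, hcomm a j i j, ← mul_assoc, hcomm i a i j, mul_assoc]
        exact h
      have e3 : q i j * q a j = q i a * q a j * q i j := by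
        have h := htrans i j a
        rw [hsymm j a] at h
        rw [← h, mul_assoc, hcomm i j a j]
      have e4 : q i a * (q i j * q a j) = q i a * q a j := by
        rw [e3, e2, ← mul_assoc, hidem]
      rw [mul_sub, mul_one, mul_sub, sub_mul, sub_mul, one_mul, one_mul, e4, e1, e3, e2]
      abel
    have hterm : ∀ i j, inner ℂ (x i) (D (q i j (x j))) =
        inner ℂ (q a i (x i)) (D (q a j (x j))) + inner ℂ (x' i) (D (q i j (x' j))) := fun i j => by
      have hc : ∀ y, D (q i a y) = q i a (D y) := fun y => DFunLike.congr_fun (hD i a) y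
      have h1 : q i j (x j) = q i a (q a j (x j)) +
          (q i j (x' j) - q i a (q i j (x' j))) := by
        conv_lhs => rw [hop i j]
        simp [x']
      rw [h1, map_add, map_sub, hc, hc, inner_add_right, inner_sub_right, ← hsa, ← hsa,
        hsymm i a, ← inner_sub_left]
    have hzl : ∀ j, q a j (x' j) = 0 := fun j => by
      have := DFunLike.congr_fun (hidem a j) (x j)
      simp only [x', map_sub]
      exact sub_eq_zero.mpr this.symm
    have haa : ∀ i, q i a * q a a = q i a := fun i => by
      have h := htrans a i a
      rw [hsymm a i, hidem] at h
      rw [hcomm]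
      exact h
    have hzr : ∀ i, q i a (x' a) = 0 := fun i => by
      have := DFunLike.congr_fun (haa i) (x a)
      simp only [x', map_sub]
      exact sub_eq_zero.mpr this.symm
    have hsum : ∑ i ∈ insert a F, ∑ j ∈ insert a F, inner ℂ (x i) (D (q i j (x j))) =
        inner ℂ (∑ i ∈ insert a F, q a i (x i)) (D (∑ j ∈ insert a F, q a j (x j))) +
          ∑ i ∈ F, ∑ j ∈ F, inner ℂ (x' i) (D (q i j (x' j))) := by
      rw [map_sum, sum_inner]
      simp only [inner_sum, hterm, Finset.sum_add_distrib]
      congr 1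
      rw [Finset.sum_insert ha]
      simp only [hzl, map_zero, inner_zero_right, Finset.sum_const_zero, zero_add]
      refine Finset.sum_congr rfl fun i _ => ?_
      rw [Finset.sum_insert ha, hzr, map_zero, inner_zero_right, zero_add]
    rw [hsum, Complex.add_re]
    exact add_nonneg (hpos _) (ih x')

namespace FellBundle.Rep

variable {S : Type u} [InverseMonoid S] {𝒜 : FellBundle.{u, v} S}
  {H : Type w} [NormedAddCommGroup H] [InnerProductSpace ℂ H] [CompleteSpace H]
  (π : 𝒜.Rep H)

theorem link_apply (s t : S) (h : H) : π.link s t h = π.one (s * t⁻¹) h := rfl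

theorem link_pos (D : H →L[ℂ] H) (hD : ∀ u, D * π.one u = π.one u * D)
    (hpos : ∀ x, 0 ≤ (inner ℂ x (D x)).re) (F : Finset S) (x : S → H) :
    0 ≤ (∑ i ∈ F, ∑ j ∈ F, inner ℂ (x i) (D (π.link i j (x j)))).re :=
  re_sum_inner_nonneg π.link D (fun _ _ => π.one_isSymmetric _) π.link_symm
    (fun _ _ => π.one_mul_one _) (fun _ _ _ _ => π.one_comm _ _) π.link_trans
    (fun _ _ => hD _) hpos F x

/-! ### Weak closures of the fibres -/

/-- The identity map from bounded operators to bounded operators with the weak operator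
topology. -/
noncomputable def toWOT : (H →L[ℂ] H) →ₗ[ℂ] (H →WOT[ℂ] H) :=
  (ContinuousLinearMapWOT.linearEquiv (σ := RingHom.id ℂ) (E := H) (F := H) ℂ).symm.toLinearMap

/-- The closure of `π(A_s)` in the weak operator topology. For the universal representation this is
the bidual `A_s''`. -/
noncomputable def vnFiber (s : S) : Submodule ℂ (H →L[ℂ] H) :=
  ((LinearMap.range (π.op s)).map toWOT).topologicalClosure.comap toWOT

theorem vnFiber_le {s : S} {M : Submodule ℂ (H →WOT[ℂ] H)} (hM : IsClosed (M : Set (H →WOT[ℂ] H)))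
    (h : ∀ a, toWOT (π.op s a) ∈ M) {y : H →L[ℂ] H} (hy : y ∈ π.vnFiber s) : toWOT y ∈ M := by
  refine Submodule.topologicalClosure_minimal _ ?_ hM hy
  rintro _ ⟨_, ⟨a, rfl⟩, rfl⟩
  exact h a

theorem vnFiber_intertwine {s : S} (Q R : H →L[ℂ] H) (h : ∀ a, π.op s a * Q = R * π.op s a)
    {y : H →L[ℂ] H} (hy : y ∈ π.vnFiber s) : y * Q = R * y := by
  let M : Submodule ℂ (H →WOT[ℂ] H) :=
    LinearMap.eqLocus
      (ContinuousLinearMapWOT.precompCLM (σ₂₃ := RingHom.id ℂ) (toWOT Q)).toLinearMap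
      (ContinuousLinearMapWOT.postcompCLM (σ₁₂ := RingHom.id ℂ) (toWOT R)).toLinearMap
  have hM : IsClosed (M : Set (H →WOT[ℂ] H)) :=
    isClosed_eq (ContinuousLinearMap.continuous _) (ContinuousLinearMap.continuous _)
  have := π.vnFiber_le hM (fun a => congrArg toWOT (h a)) hy
  exact ContinuousLinearMapWOT.ofCLM_injective this

theorem op_mul_mem_vnFiber {s t : S} (a : 𝒜.fiber s) {y : H →L[ℂ] H} (hy : y ∈ π.vnFiber t) :
    π.op s a * y ∈ π.vnFiber (s * t) := by
  let N := ((LinearMap.range (π.op (s * t))).map (toWOT (H := H))).topologicalClosure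
  let M : Submodule ℂ (H →WOT[ℂ] H) := 
    N.comap (ContinuousLinearMapWOT.postcompCLM (σ₁₂ := RingHom.id ℂ) (toWOT (π.op s a))).toLinearMap
  have hM : IsClosed (M : Set (H →WOT[ℂ] H)) :=
    (Submodule.isClosed_topologicalClosure _).preimage (ContinuousLinearMap.continuous _)
  refine π.vnFiber_le hM (fun b => ?_) hy
  change toWOT (π.op s a * π.op t b) ∈ N
  rw [π.op_mul]
  exact Submodule.le_topologicalClosure _ ⟨_, ⟨_, rfl⟩, rfl⟩

theorem vnFiber_swap {t : S} {y : H →L[ℂ] H} (hy : y ∈ π.vnFiber t) (s : S) (x : H) :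
    y (π.one (s⁻¹ * t) x) = π.one (s * t⁻¹) (y x) :=
  DFunLike.congr_fun (π.vnFiber_intertwine _ _ (fun a => π.op_mul_one_swap a s) hy) x

theorem vnFiber_apply_mem {t : S} {y : H →L[ℂ] H} (hy : y ∈ π.vnFiber t) (x : H) :
    y x ∈ π.unitSpace (t * t⁻¹) 1 := by
  have h := π.vnFiber_intertwine (s := t) 1 (π.one (t * t⁻¹)) (fun a => ?_) hy
  · have := DFunLike.congr_fun h x
    rw [show y x = π.one (t * t⁻¹) (y x) from this]
    exact π.one_apply_mem _ _
  · rw [mul_one]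
    ext z
    exact (π.one_apply_eq (π.op_mem_unitSpace (le_refl' _) a z)).symm

/-! ### An auxiliary space -/

/-- The positive semidefinite form `⟪x, y⟫ = ∑_{s,t} ⟪x s, 1_{s t^*} (y t)⟫` on the finitely
supported functions `S → H`. -/
@[reducible]
noncomputable def auxCore : PreInnerProductSpace.Core ℂ (S →₀ H) where
  inner x y := x.sum fun s h => y.sum fun t k => inner ℂ h (π.link s t k)
  conj_inner_symm x y := by
    simp only [Finsupp.sum, map_sum, inner_conj_symm]
    rw [Finset.sum_comm]
    refine Finset.sum_congr rfl fun s _ => Finset.sum_congr rfl fun t _ => ?_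
    rw [π.link_symm s t]
    exact π.one_isSymmetric _ _ _
  re_inner_nonneg x :=
    π.link_pos 1 (fun u => by rw [one_mul, mul_one])
      (fun x => inner_self_nonneg (𝕜 := ℂ) (x := x)) x.support x
  add_left x y z := by
    refine Finsupp.sum_add_index' (fun s => ?_) (fun s h k => ?_)
    · simp [Finsupp.sum]
    · simp only [Finsupp.sum, inner_add_left, Finset.sum_add_distrib]
  smul_left x y r := by
    have h := Finsupp.sum_smul_index' (g := x) (b := r)
      (h := fun s h => y.sum fun t k => inner ℂ h (π.link s t k))
      (fun s => by simp [Finsupp.sum])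
    refine h.trans ?_
    simp only [Finsupp.sum, Finset.mul_sum, inner_smul_left]

/-- The finitely supported functions `S → H` with the form `auxCore`. -/
def Aux (π : 𝒜.Rep H) : Type (max u w) := S →₀ H

noncomputable instance : SeminormedAddCommGroup π.Aux :=
  @InnerProductSpace.Core.toSeminormedAddCommGroup ℂ (S →₀ H) _ _ _ π.auxCore

noncomputable instance : InnerProductSpace ℂ π.Aux :=
  InnerProductSpace.ofCore (F := S →₀ H) π.auxCore

/-- The identity map onto the auxiliary space. -/
noncomputable def toAux : (S →₀ H) ≃ₗ[ℂ] π.Aux where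
  toFun x := x
  invFun x := x
  map_add' _ _ := rfl
  map_smul' _ _ := rfl
  left_inv _ := rfl
  right_inv _ := rfl

/-- The function with value `h` at `s` and zero elsewhere. -/
noncomputable def auxSingle (s : S) : H →ₗ[ℂ] π.Aux := π.toAux.toLinearMap ∘ₗ Finsupp.lsingle s

theorem inner_auxSingle (s t : S) (h k : H) :
    inner ℂ (π.auxSingle s h) (π.auxSingle t k) = inner ℂ h (π.link s t k) := by
  change Finsupp.sum (Finsupp.single s h) (fun s h => Finsupp.sum (Finsupp.single t k)
    fun t k => inner ℂ h (π.link s t k)) = _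
  rw [Finsupp.sum_single_index (by simp [Finsupp.sum]), Finsupp.sum_single_index (by simp)]

theorem aux_eq_sum (x : π.Aux) :
    ∃ (F : Finset S) (y : S → H), x = ∑ s ∈ F, π.auxSingle s (y s) := by
  let y : S →₀ H := π.toAux.symm x
  refine ⟨y.support, y, ?_⟩
  have h : ∑ s ∈ y.support, Finsupp.single s (y s) = y := Finsupp.sum_single y
  have h2 := congrArg π.toAux h
  rw [map_sum] at h2
  exact h2.symm

/-- `a δ_s` acts on the auxiliary space by `h δ_t ↦ π_s(a) h δ_{st}`. -/
noncomputable def auxActHom (s : S) : 𝒜.fiber s →ₗ[ℂ] (π.Aux →ₗ[ℂ] π.Aux) :=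
  LinearMap.flip <| (Finsupp.lsum ℂ fun t =>
    ((ContinuousLinearMap.coeLM ℂ ∘ₗ π.op s).compr₂ (π.auxSingle (s * t))).flip) ∘ₗ
      π.toAux.symm.toLinearMap

theorem auxActHom_single {s t : S} (a : 𝒜.fiber s) (h : H) :
    π.auxActHom s a (π.auxSingle t h) = π.auxSingle (s * t) (π.op s a h) := by
  simp [auxActHom, auxSingle]

/-- The action of `C_c(𝒜)` on the auxiliary space. -/
noncomputable def auxAct : 𝒜.Cc →ₗ[ℂ] (π.Aux →ₗ[ℂ] π.Aux) := 𝒜.lift π.auxActHom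

theorem auxAct_single {s t : S} (a : 𝒜.fiber s) (h : H) :
    π.auxAct (𝒜.single s a) (π.auxSingle t h) = π.auxSingle (s * t) (π.op s a h) := by
  rw [auxAct, lift_single, auxActHom_single]

theorem norm_auxAct_le {s : S} (a : 𝒜.fiber s) (x : π.Aux) :
    ‖π.auxAct (𝒜.single s a) x‖ ≤ ‖π.op s a‖ * ‖x‖ := by
  obtain ⟨F, y, rfl⟩ := π.aux_eq_sum x
  set T := π.op s a with hT
  have hconj : ∀ u, T * π.one u = π.one (s * u * s⁻¹) * T := fun u => π.op_mul_one_conj a u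
  let D : H →L[ℂ] H := ((‖T‖ ^ 2 : ℝ) : ℂ) • 1 - star T * T
  have hTT : ∀ u, star T * T * π.one u = π.one u * (star T * T) := fun u => by
    have h := congrArg star (hconj u)
    rw [star_mul, star_mul, star_one, star_one] at h
    rw [mul_assoc, hconj, ← mul_assoc, ← h, mul_assoc]
  have hD : ∀ u, D * π.one u = π.one u * D := fun u => by
    simp only [D, sub_mul, mul_sub, hTT, smul_mul_assoc, mul_smul_comm, one_mul, mul_one]
  have hin : ∀ h k, inner ℂ h (D k) = ((‖T‖ ^ 2 : ℝ) : ℂ) * inner ℂ h k - inner ℂ (T h) (T k) :=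
    fun h k => by
      rw [← ContinuousLinearMap.adjoint_inner_right, ← ContinuousLinearMap.star_eq_adjoint]
      simp [D]
  have hpos : ∀ h, 0 ≤ (inner ℂ h (D h)).re := fun h => by
    rw [hin, inner_self_eq_norm_sq_to_K, inner_self_eq_norm_sq_to_K]
    have h1 : ‖T h‖ ^ 2 ≤ ‖T‖ ^ 2 * ‖h‖ ^ 2 := by
      rw [← mul_pow]
      exact pow_le_pow_left₀ (norm_nonneg _) (T.le_opNorm h) 2
    have h2 : (((‖T‖ ^ 2 : ℝ) : ℂ) * (‖h‖ : ℂ) ^ 2 - (‖T h‖ : ℂ) ^ 2).re =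
        ‖T‖ ^ 2 * ‖h‖ ^ 2 - ‖T h‖ ^ 2 := by
      norm_cast
    exact (sub_nonneg.mpr h1).trans_eq h2.symm
  have key := π.link_pos D hD hpos F y
  have hlink : ∀ i j h, π.link (s * i) (s * j) (T h) = T (π.link i j h) := fun i j h => by
    have := DFunLike.congr_fun (hconj (i * j⁻¹)) h
    have h2 : s * i * (s * j)⁻¹ = s * (i * j⁻¹) * s⁻¹ := by
      rw [mul_inv_rev']; simp only [mul_assoc]
    rw [link, h2]
    exact this.symm
  have e1 : (inner ℂ (∑ i ∈ F, π.auxSingle i (y i)) (∑ i ∈ F, π.auxSingle i (y i))) =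
      ∑ i ∈ F, ∑ j ∈ F, inner ℂ (y i) (π.link i j (y j)) := by
    rw [sum_inner]
    simp only [inner_sum, inner_auxSingle]
  have e2 : (inner ℂ (π.auxAct (𝒜.single s a) (∑ i ∈ F, π.auxSingle i (y i)))
      (π.auxAct (𝒜.single s a) (∑ i ∈ F, π.auxSingle i (y i)))) =
      ∑ i ∈ F, ∑ j ∈ F, inner ℂ (T (y i)) (T (π.link i j (y j))) := by
    simp only [map_sum, auxAct_single]
    rw [sum_inner]
    simp only [inner_sum, inner_auxSingle]
    exact Finset.sum_congr rfl fun i _ => Finset.sum_congr rfl fun j _ => by rw [hlink]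
  refine le_of_sq_le_sq ?_ (by positivity)
  rw [mul_pow, norm_sq_eq_re_inner (𝕜 := ℂ), norm_sq_eq_re_inner (𝕜 := ℂ) (∑ i ∈ F, _), e1, e2]
  simp only [hin, Finset.sum_sub_distrib, ← Finset.mul_sum] at key
  rw [Complex.sub_re, Complex.re_ofReal_mul] at key
  exact sub_nonneg.mp key

theorem auxAct_adjoint (x : 𝒜.Cc) (k l : π.Aux) :
    inner ℂ (π.auxAct x k) l = inner ℂ k (π.auxAct (star x) l) := by
  induction x using Cc.induction with
  | zero => simp
  | add x y hx hy => simp only [map_add, star_add, LinearMap.add_apply, inner_add_left,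
      inner_add_right, hx, hy]
  | single s a =>
    obtain ⟨F, y, rfl⟩ := π.aux_eq_sum k
    obtain ⟨G, z, rfl⟩ := π.aux_eq_sum l
    rw [star_single]
    simp only [map_sum, auxAct_single, sum_inner, inner_sum, inner_auxSingle]
    refine Finset.sum_congr rfl fun r _ => Finset.sum_congr rfl fun t _ => ?_
    rw [← π.op_adj, ContinuousLinearMap.star_eq_adjoint]
    have h : π.op s a * π.link t (s⁻¹ * r) = π.link (s * t) r * π.op s a := by
      refine π.op_mul_one_eq a (fun e _ hes => ?_) (fun e _ hes => ?_)
      · have h2 : s * e * s⁻¹ ≤ s * (t * (s⁻¹ * r)⁻¹) * s⁻¹ :=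
          mul_le_mul'' (mul_le_mul'' (le_refl' _) hes) (le_refl' _)
        have h3 : s * (t * (s⁻¹ * r)⁻¹) * s⁻¹ = (s * t * r⁻¹) * (s * s⁻¹) := by
          rw [mul_inv_rev', inv_inv']; simp only [mul_assoc]
        rw [h3] at h2
        exact le_trans' h2 (mul_idem_le _ (idem_mul_inv s))
      · have h2 : s⁻¹ * e * s ≤ s⁻¹ * (s * t * r⁻¹) * s :=
          mul_le_mul'' (mul_le_mul'' (le_refl' _) hes) (le_refl' _)
        have h3 : s⁻¹ * (s * t * r⁻¹) * s = (s⁻¹ * s) * (t * (s⁻¹ * r)⁻¹) := by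
          rw [mul_inv_rev', inv_inv']; simp only [mul_assoc]
        rw [h3] at h2
        exact le_trans' h2 (idem_mul_le (idem_inv_mul s) _)
    have h' : π.op s a (π.link t (s⁻¹ * r) (y t)) = π.link (s * t) r (π.op s a (y t)) :=
      DFunLike.congr_fun h (y t)
    rw [link_apply π (s * t), ← π.one_isSymmetric, link_apply π t, ← π.one_isSymmetric,
      ContinuousLinearMap.adjoint_inner_right]
    exact congrArg (fun v => inner ℂ v (z r)) h'.symm

end FellBundle.Rep

namespace FellBundle.Rep

variable {S : Type u} [InverseMonoid S] {𝒜 : FellBundle.{u, v} S}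
  {H : Type w} [NormedAddCommGroup H] [InnerProductSpace ℂ H] [CompleteSpace H]
  (π : 𝒜.Rep H)

/-! ### The Hilbert module `ℓ²(𝒜'')` -/

/-- The space `C_c(𝒜'')` of finitely supported sections of the fibres `A_s''`. -/
def ccVN : Submodule ℂ (S →₀ (H →L[ℂ] H)) where
  carrier := {f | ∀ s, f s ∈ π.vnFiber s}
  zero_mem' _ := Submodule.zero_mem _
  add_mem' hf hg s := Submodule.add_mem _ (hf s) (hg s)
  smul_mem' c _ hf s := Submodule.smul_mem _ c (hf s)

/-- The weak conditional expectation `P''(x δ_s) = x 1_s`, with values in `A_1''`. (All `A_s''` are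
regarded as subspaces of `B(H)`, so that `A_v''` is contained in `A_s''` for `v ≤ s` and the
isomorphism from `A_s'' 1_s` onto `A_1'' 1_s` is the identity.) -/
noncomputable def condExp : (S →₀ (H →L[ℂ] H)) →ₗ[ℂ] (H →L[ℂ] H) :=
  Finsupp.lsum ℂ fun s => LinearMap.mulRight ℂ (π.one s)

/-- The inner product `⟨f, g⟩ = P''(f^* g)`, where `(x δ_s)^* (y δ_t) = x^* y δ_{s^* t}`. -/
noncomputable def vnInner (f g : S →₀ (H →L[ℂ] H)) : H →L[ℂ] H :=
  f.sum fun s x => g.sum fun t y => π.condExp (Finsupp.single (s⁻¹ * t) (star x * y))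

/-- The action of `C_c(𝒜)` by left multiplication, `(a δ_s) (y δ_t) = π_s(a) y δ_{st}`. -/
noncomputable def act :
    𝒜.Cc →ₗ[ℂ] ((S →₀ (H →L[ℂ] H)) →ₗ[ℂ] (S →₀ (H →L[ℂ] H))) :=
  𝒜.lift fun s => LinearMap.flip <| Finsupp.lsum ℂ fun t =>
    ((LinearMap.mul ℂ (H →L[ℂ] H) ∘ₗ π.op s).compr₂ (Finsupp.lsingle (s * t))).flip

theorem act_single {s t : S} (a : 𝒜.fiber s) (y : H →L[ℂ] H) :
    π.act (𝒜.single s a) (Finsupp.single t y) = Finsupp.single (s * t) (π.op s a * y) := by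
  simp [act]

theorem act_mul (x y : 𝒜.Cc) (f : S →₀ (H →L[ℂ] H)) :
    π.act (x * y) f = π.act x (π.act y f) := by
  induction f using Finsupp.induction_linear with
  | zero => simp only [map_zero]
  | add f g hf hg => simp only [map_add, hf, hg]
  | single r z =>
    induction x using Cc.induction with
    | zero => simp only [zero_mul, map_zero, LinearMap.zero_apply]
    | add x x' hx hx' => simp only [add_mul, map_add, LinearMap.add_apply, hx, hx']
    | single s a =>
      induction y using Cc.induction with
      | zero => simp only [mul_zero, map_zero, LinearMap.zero_apply]
      | add x x' hx hx' => simp only [mul_add, map_add, LinearMap.add_apply, hx, hx']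
      | single t b =>
        rw [single_mul_single, act_single, act_single, act_single, ← π.op_mul, mul_assoc,
          mul_assoc]

theorem single_mem_ccVN {t : S} {y : H →L[ℂ] H} (hy : y ∈ π.vnFiber t) :
    Finsupp.single t y ∈ π.ccVN := by
  classical
  intro s
  rw [Finsupp.single_apply]
  split_ifs with h
  · subst h; exact hy
  · exact Submodule.zero_mem _

theorem act_mem (x : 𝒜.Cc) {f : S →₀ (H →L[ℂ] H)} (hf : f ∈ π.ccVN) : π.act x f ∈ π.ccVN := by
  induction x using Cc.induction with
  | zero => simp only [map_zero, LinearMap.zero_apply, Submodule.zero_mem]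
  | add x y hx hy =>
    rw [map_add, LinearMap.add_apply]
    exact Submodule.add_mem _ hx hy
  | single s a =>
    rw [← Finsupp.sum_single f, Finsupp.sum, map_sum]
    refine Submodule.sum_mem _ fun t _ => ?_
    rw [act_single]
    exact π.single_mem_ccVN (π.op_mul_mem_vnFiber a (hf t))

/-- Evaluation of a section at a vector. -/
noncomputable def evalAt (v : H) : (S →₀ (H →L[ℂ] H)) →ₗ[ℂ] π.Aux :=
  Finsupp.lsum ℂ fun s => π.auxSingle s ∘ₗ (ContinuousLinearMap.apply ℂ H v).toLinearMap

theorem evalAt_single (v : H) (s : S) (y : H →L[ℂ] H) :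
    π.evalAt v (Finsupp.single s y) = π.auxSingle s (y v) := by
  simp [evalAt]

theorem evalAt_eq_sum (v : H) (f : S →₀ (H →L[ℂ] H)) :
    π.evalAt v f = ∑ s ∈ f.support, π.auxSingle s (f s v) := rfl

theorem evalAt_act (v : H) (x : 𝒜.Cc) (f : S →₀ (H →L[ℂ] H)) :
    π.evalAt v (π.act x f) = π.auxAct x (π.evalAt v f) := by
  induction f using Finsupp.induction_linear with
  | zero => simp only [map_zero]
  | add f g hf hg => simp only [map_add, hf, hg]
  | single t y =>
    induction x using Cc.induction with
    | zero => simp only [map_zero, LinearMap.zero_apply]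
    | add x x' hx hx' => simp only [map_add, LinearMap.add_apply, hx, hx']
    | single s a => rw [act_single, evalAt_single, evalAt_single, auxAct_single]; rfl

theorem inner_evalAt (f : S →₀ (H →L[ℂ] H)) {g : S →₀ (H →L[ℂ] H)} (hg : g ∈ π.ccVN) (v w : H) :
    inner ℂ (π.evalAt v f) (π.evalAt w g) = inner ℂ v (π.vnInner f g w) := by
  rw [evalAt_eq_sum, evalAt_eq_sum, sum_inner, vnInner, Finsupp.sum]
  simp only [Finsupp.sum, sum_apply, inner_sum, inner_auxSingle]
  refine Finset.sum_congr rfl fun s _ => Finset.sum_congr rfl fun t _ => ?_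
  have h : π.condExp (Finsupp.single (s⁻¹ * t) (star (f s) * g t)) w =
      star (f s) (g t (π.one (s⁻¹ * t) w)) := by
    rw [condExp, Finsupp.lsum_single]
    rfl
  rw [h, π.vnFiber_swap (hg t), ContinuousLinearMap.star_eq_adjoint,
    ContinuousLinearMap.adjoint_inner_right, link_apply]

theorem norm_evalAt_le (f : π.ccVN) (v : H) :
    ‖π.evalAt v f‖ ≤ Real.sqrt ‖π.vnInner f f‖ * ‖v‖ := by
  refine le_of_sq_le_sq ?_ (by positivity)
  rw [mul_pow, Real.sq_sqrt (norm_nonneg _), norm_sq_eq_re_inner (𝕜 := ℂ), π.inner_evalAt _ f.2]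
  refine (RCLike.re_le_norm _).trans ((norm_inner_le_norm _ _).trans ?_)
  have := (π.vnInner f f).le_opNorm v
  nlinarith [norm_nonneg v]

/-- The operator `H → Aux` defined by a section. -/
noncomputable def evalCLM : π.ccVN →ₗ[ℂ] (H →L[ℂ] π.Aux) where
  toFun f := LinearMap.mkContinuous
    { toFun := fun v => π.evalAt v f
      map_add' := fun v w => by
        simp only [evalAt_eq_sum, map_add, Finset.sum_add_distrib]
      map_smul' := fun c v => by
        simp only [evalAt_eq_sum, map_smul, Finset.smul_sum, RingHom.id_apply] }
    (Real.sqrt ‖π.vnInner f f‖) (π.norm_evalAt_le f)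
  map_add' f g := by ext v; exact map_add (π.evalAt v) _ _
  map_smul' c f := by ext v; exact map_smul (π.evalAt v) _ _

theorem evalCLM_apply (f : π.ccVN) (v : H) : π.evalCLM f v = π.evalAt v f := rfl

theorem norm_vnInner_le (f g : π.ccVN) : ‖π.vnInner f g‖ ≤ ‖π.evalCLM f‖ * ‖π.evalCLM g‖ := by
  refine ContinuousLinearMap.opNorm_le_bound _ (by positivity) fun w => ?_
  set y := π.vnInner f g w with hy
  have h1 : ‖y‖ ^ 2 ≤ (‖π.evalCLM f‖ * ‖y‖) * (‖π.evalCLM g‖ * ‖w‖) := by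
    rw [norm_sq_eq_re_inner (𝕜 := ℂ)]
    nth_rewrite 2 [hy]
    rw [← π.inner_evalAt _ g.2]
    refine (RCLike.re_le_norm _).trans ((norm_inner_le_norm _ _).trans ?_)
    exact mul_le_mul ((π.evalCLM f).le_opNorm y) ((π.evalCLM g).le_opNorm w) (norm_nonneg _)
      (by positivity)
  rcases (norm_nonneg y).eq_or_lt with h0 | h0
  · rw [← h0]; positivity
  · refine le_of_mul_le_mul_right ?_ h0
    calc ‖y‖ * ‖y‖ = ‖y‖ ^ 2 := (sq _).symm
      _ ≤ _ := h1
      _ = _ := by ring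

theorem norm_evalCLM (f : π.ccVN) : ‖π.evalCLM f‖ = Real.sqrt ‖π.vnInner f f‖ := by
  refine le_antisymm
    (ContinuousLinearMap.opNorm_le_bound _ (Real.sqrt_nonneg _) (π.norm_evalAt_le f)) ?_
  refine Real.sqrt_le_iff.mpr ⟨norm_nonneg _, ?_⟩
  rw [sq]
  exact π.norm_vnInner_le f f

/-- The space `C_c(𝒜'')` with the seminorm `‖⟨f, f⟩‖^{1/2}`. -/
def PreEll2 : Type (max u w) := π.ccVN

noncomputable instance : AddCommGroup π.PreEll2 := inferInstanceAs (AddCommGroup π.ccVN)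
noncomputable instance : Module ℂ π.PreEll2 := inferInstanceAs (Module ℂ π.ccVN)

/-- The underlying section of an element of `PreEll2`. -/
noncomputable def toCcVN : π.PreEll2 →ₗ[ℂ] π.ccVN := LinearMap.id

noncomputable instance : SeminormedAddCommGroup π.PreEll2 :=
  AddGroupSeminorm.toSeminormedAddCommGroup (E := π.PreEll2)
    { toFun := fun f => Real.sqrt ‖π.vnInner (π.toCcVN f) (π.toCcVN f)‖
      map_zero' := by rw [← norm_evalCLM, map_zero, map_zero, norm_zero]
      add_le' := fun f g => by
        simp only [← norm_evalCLM, map_add]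
        exact norm_add_le _ _
      neg' := fun f => by simp only [← norm_evalCLM, map_neg, norm_neg] }

theorem norm_def (f : π.PreEll2) : ‖f‖ = Real.sqrt ‖π.vnInner (π.toCcVN f) (π.toCcVN f)‖ := rfl

theorem norm_eq (f : π.PreEll2) : ‖f‖ = ‖π.evalCLM (π.toCcVN f)‖ :=
  (π.norm_evalCLM (π.toCcVN f)).symm

noncomputable instance : NormedSpace ℂ π.PreEll2 where
  norm_smul_le c f := by
    rw [norm_eq, norm_eq, map_smul, map_smul, norm_smul]

/-- The Hilbert module `ℓ²(𝒜'')`: the Hausdorff completion of `C_c(𝒜'')` with respect to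
`‖f‖ = ‖⟨f, f⟩‖^{1/2}`. -/
abbrev Ell2 : Type (max u w) := UniformSpace.Completion π.PreEll2

/-- Left multiplication by an element of `C_c(𝒜)` on `C_c(𝒜'')`. -/
noncomputable def preAct : 𝒜.Cc →ₗ[ℂ] (π.PreEll2 →ₗ[ℂ] π.PreEll2) where
  toFun x := (π.act x).restrict (p := π.ccVN) (q := π.ccVN) fun _ hf => π.act_mem x hf
  map_add' x y := by
    refine LinearMap.ext fun f => Subtype.ext ?_
    change π.act (x + y) _ = π.act x _ + π.act y _
    rw [map_add, LinearMap.add_apply]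
  map_smul' c x := by
    refine LinearMap.ext fun f => Subtype.ext ?_
    change π.act (c • x) _ = c • π.act x _
    rw [map_smul, LinearMap.smul_apply]

theorem evalCLM_preAct (x : 𝒜.Cc) (f : π.PreEll2) (v : H) :
    π.evalCLM (π.toCcVN (π.preAct x f)) v = π.auxAct x (π.evalCLM (π.toCcVN f) v) :=
  π.evalAt_act v x (π.toCcVN f)

theorem preAct_mul (x y : 𝒜.Cc) (f : π.PreEll2) :
    π.preAct (x * y) f = π.preAct x (π.preAct y f) :=
  Subtype.ext (π.act_mul x y _)

theorem preAct_bound (x : 𝒜.Cc) : ∃ C : ℝ, ∀ f : π.PreEll2, ‖π.preAct x f‖ ≤ C * ‖f‖ := by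
  induction x using Cc.induction with
  | zero => exact ⟨0, fun f => by simp⟩
  | add x y hx hy =>
    obtain ⟨C, hC⟩ := hx
    obtain ⟨D, hD⟩ := hy
    refine ⟨C + D, fun f => ?_⟩
    rw [map_add, LinearMap.add_apply, add_mul]
    exact (norm_add_le _ _).trans (add_le_add (hC f) (hD f))
  | single s a =>
    refine ⟨‖π.op s a‖, fun f => ?_⟩
    rw [norm_eq, norm_eq]
    refine ContinuousLinearMap.opNorm_le_bound _ (by positivity) fun v => ?_
    rw [evalCLM_preAct, mul_assoc]
    exact (π.norm_auxAct_le a _).trans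
      (mul_le_mul_of_nonneg_left ((π.evalCLM _).le_opNorm v) (norm_nonneg _))

/-- Left multiplication by an element of `C_c(𝒜)`, as a bounded operator on `C_c(𝒜'')`. -/
noncomputable def preActCLM (x : 𝒜.Cc) : π.PreEll2 →L[ℂ] π.PreEll2 where
  toLinearMap := π.preAct x
  cont := AddMonoidHomClass.continuous_of_bound (π.preAct x) _ (π.preAct_bound x).choose_spec

theorem preActCLM_apply (x : 𝒜.Cc) (f : π.PreEll2) : π.preActCLM x f = π.preAct x f := rfl

/-- The regular representation `Λ` of `C_c(𝒜)` on `ℓ²(𝒜'')`, by left multiplication. -/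
noncomputable def regular (x : 𝒜.Cc) : π.Ell2 →L[ℂ] π.Ell2 := (π.preActCLM x).completion

theorem regular_coe (x : 𝒜.Cc) (f : π.PreEll2) :
    π.regular x (f : π.Ell2) = ((π.preAct x f : π.PreEll2) : π.Ell2) :=
  UniformSpace.Completion.map_coe (π.preActCLM x).uniformContinuous f

theorem regular_ext {T U : π.Ell2 →L[ℂ] π.Ell2} (h : ∀ f : π.PreEll2, T (f : π.Ell2) = U f) :
    T = U :=
  ContinuousLinearMap.ext fun z => congrFun
    (UniformSpace.Completion.ext T.continuous U.continuous h) z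

theorem regular_add (x y : 𝒜.Cc) : π.regular (x + y) = π.regular x + π.regular y :=
  π.regular_ext fun f => by
    simp only [add_apply, regular_coe, map_add, LinearMap.add_apply,
      UniformSpace.Completion.coe_add]

theorem regular_smul (c : ℂ) (x : 𝒜.Cc) : π.regular (c • x) = c • π.regular x :=
  π.regular_ext fun f => by
    simp only [smul_apply, regular_coe, map_smul, LinearMap.smul_apply,
      UniformSpace.Completion.coe_smul]

theorem regular_mul (x y : 𝒜.Cc) : π.regular (x * y) = π.regular x * π.regular y :=
  π.regular_ext fun f => by
    change _ = π.regular x (π.regular y f)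
    rw [regular_coe, regular_coe, regular_coe, preAct_mul]

theorem norm_regular_le {x : 𝒜.Cc} {C : ℝ} (hC : 0 ≤ C)
    (h : ∀ f : π.PreEll2, ‖π.preAct x f‖ ≤ C * ‖f‖) : ‖π.regular x‖ ≤ C := by
  refine ContinuousLinearMap.opNorm_le_bound _ hC fun z => ?_
  induction z using UniformSpace.Completion.induction_on with
  | hp => exact isClosed_le (by fun_prop) (by fun_prop)
  | ih f =>
    rw [regular_coe, UniformSpace.Completion.norm_coe, UniformSpace.Completion.norm_coe]
    exact h f

theorem norm_preAct_le (x : 𝒜.Cc) (f : π.PreEll2) : ‖π.preAct x f‖ ≤ ‖π.regular x‖ * ‖f‖ := by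
  have := (π.regular x).le_opNorm (f : π.Ell2)
  rwa [regular_coe, UniformSpace.Completion.norm_coe, UniformSpace.Completion.norm_coe] at this

theorem norm_regular_sq_le (x : 𝒜.Cc) : ‖π.regular x‖ ^ 2 ≤ ‖π.regular (star x * x)‖ := by
  rw [← Real.le_sqrt (norm_nonneg _) (norm_nonneg _)]
  refine π.norm_regular_le (Real.sqrt_nonneg _) fun f => ?_
  rw [norm_eq]
  refine ContinuousLinearMap.opNorm_le_bound _ (by positivity) fun v => ?_
  refine le_of_sq_le_sq ?_ (by positivity)
  rw [mul_pow, mul_pow, Real.sq_sqrt (norm_nonneg _), norm_sq_eq_re_inner (𝕜 := ℂ)]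
  nth_rewrite 1 [evalCLM_preAct]
  rw [auxAct_adjoint, ← evalCLM_preAct, ← preAct_mul]
  refine (RCLike.re_le_norm _).trans ((norm_inner_le_norm _ _).trans ?_)
  have h1 := (π.evalCLM (π.toCcVN f)).le_opNorm v
  have h2 := (π.evalCLM (π.toCcVN (π.preAct (star x * x) f))).le_opNorm v
  have h3 := π.norm_preAct_le (star x * x) f
  rw [← norm_eq] at h1 h2
  have h4 := h2.trans (mul_le_mul_of_nonneg_right h3 (norm_nonneg v))
  have h5 : 0 ≤ ‖π.evalCLM (π.toCcVN (π.preAct (star x * x) f)) v‖ := norm_nonneg _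
  have h6 : 0 ≤ ‖f‖ * ‖v‖ := mul_nonneg (norm_nonneg f) (norm_nonneg v)
  generalize ‖π.evalCLM (π.toCcVN (π.preAct (star x * x) f)) v‖ = b at *
  generalize ‖π.evalCLM (π.toCcVN f) v‖ = c at *
  generalize ‖π.regular (star x * x)‖ = r at *
  calc c * b ≤ (‖f‖ * ‖v‖) * (r * ‖f‖ * ‖v‖) := mul_le_mul h1 h4 h5 h6
    _ = r * ‖f‖ ^ 2 * ‖v‖ ^ 2 := by ring

/-- The reduced seminorm `‖x‖_r = ‖Λ(x)‖` on `C_c(𝒜)`. -/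
noncomputable def redSeminorm : CStarSeminorm 𝒜.Cc :=
  CStarSeminorm.ofLe
    { toFun := fun x => ‖π.regular x‖
      map_zero' := by
        have := π.regular_smul 0 0
        rw [zero_smul, zero_smul] at this
        rw [this, norm_zero]
      add_le' := fun x y => by
        rw [regular_add]
        exact norm_add_le _ _
      neg' := fun x => by rw [← neg_one_smul ℂ x, regular_smul, norm_smul, norm_neg, norm_one, one_mul]
      smul' := fun c x => by rw [regular_smul, norm_smul] }
    (fun x y => by
      change ‖π.regular (x * y)‖ ≤ ‖π.regular x‖ * ‖π.regular y‖
      rw [regular_mul]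
      exact norm_mul_le _ _)
    π.norm_regular_sq_le

theorem redSeminorm_apply (x : 𝒜.Cc) : π.redSeminorm.toSeminorm x = ‖π.regular x‖ := rfl

theorem norm_auxSingle_sub {u w : S} (h : u ≤ w) {k : H} (hk : k ∈ π.unitSpace (u * u⁻¹) 1) :
    ‖π.auxSingle u k - π.auxSingle w k‖ = 0 := by
  have hl : ∀ r s : S, u ≤ r → u ≤ s → π.link r s k = k := fun r s hr hs =>
    π.one_apply_eq (π.unitSpace_mono (mul_le_mul'' hr (inv_le_inv' hs)) hk)
  have hu := le_refl' u
  rw [← sq_eq_zero_iff, norm_sq_eq_re_inner (𝕜 := ℂ)]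
  simp only [inner_sub_left, inner_sub_right, inner_auxSingle, hl _ _ hu hu, hl _ _ hu h,
    hl _ _ h hu, hl _ _ h h, sub_self, map_zero]

theorem redSeminorm_admissible : 𝒜.Admissible π.redSeminorm := by
  intro s t h a
  rw [redSeminorm_apply]
  refine le_antisymm (π.norm_regular_le le_rfl fun f => ?_) (norm_nonneg _)
  rw [zero_mul, norm_eq]
  refine ContinuousLinearMap.opNorm_le_bound _ le_rfl fun v => ?_
  rw [zero_mul, evalCLM_preAct, evalCLM_apply, evalAt_eq_sum, map_sum]
  refine (norm_sum_le _ _).trans (Finset.sum_nonpos fun r _ => ?_)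
  rw [map_sub, LinearMap.sub_apply, auxAct_single, auxAct_single, π.op_incl]
  refine (π.norm_auxSingle_sub (mul_le_mul'' h (le_refl' r)) ?_).le
  refine π.op_map_unitSpace a (u := r * r⁻¹) (fun e _ he => ?_) _
    (π.vnFiber_apply_mem ((π.toCcVN f).2 r) v)
  have h1 : s * r * (s * r)⁻¹ = s * (r * r⁻¹) * s⁻¹ := by
    rw [mul_inv_rev']; simp only [mul_assoc]
  rw [h1]
  exact mul_le_mul'' (mul_le_mul'' (le_refl' s) he) (le_refl' _)

end FellBundle.Rep

namespace FellBundle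

variable {S : Type u} [InverseMonoid S] (𝒜 : FellBundle.{u, v} S)

/-- The reduced cross-sectional C*-algebra `C^*_r(𝒜)`: the completion of `C_c(𝒜)` in the norm
`‖x‖_r = ‖Λ(x)‖`, i.e. the closure of `Λ(C_c(𝒜))` in the adjointable operators on `ℓ²(𝒜'')`. -/
abbrev RedAlg : Type (max u v) := 𝒜.univRep.redSeminorm.Compl

/-- The regular representation `Λ : C^*(𝒜) → C^*_r(𝒜)`, the extension of the identity of
`C_c(𝒜)`. -/
noncomputable def regularRep : 𝒜.FullAlg →⋆ₙₐ[ℂ] 𝒜.RedAlg :=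
  CStarSeminorm.mapCompl 𝒜.maxSeminorm 𝒜.univRep.redSeminorm
    (𝒜.le_maxSeminorm _ 𝒜.univRep.redSeminorm_admissible)

/-- The weak containment property: `Λ : C^*(𝒜) → C^*_r(𝒜)` is a *-isomorphism. -/
def HasWeakContainmentProperty : Prop := Function.Bijective 𝒜.regularRep

open Filter Topology in
/-- The approximation property: there is a net `ξ_i` of finitely supported functions
`ξ_i : S → A_1` with `ξ_i(s) ∈ A_{s s^*}` such that the norms of
`∑_{p,t} ξ_i(p)^* ξ_i(t) 1_{p t^*}` are bounded, and
`∑_{p,t} 1_{p (s t)^*} ξ_i(p)^* a ξ_i(t) → a` in norm for all `s` and `a ∈ A_s`. The expressions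
are formed in the enveloping von Neumann algebra of `C^*(𝒜)`. -/
def HasApproximationProperty : Prop :=
  ∃ (I : Type w) (_ : Preorder I) (_ : IsDirectedOrder I) (_ : Nonempty I)
    (ξ : I → (S →₀ 𝒜.fiber 1)),
    (∀ i s, ξ i s ∈ Set.range (𝒜.incl (mul_inv_le_one s))) ∧
    (∃ C : ℝ, ∀ i, ‖(ξ i).sum fun p x => (ξ i).sum fun t y =>
      star (𝒜.univRep.op 1 x) * 𝒜.univRep.op 1 y * 𝒜.univRep.one (p * t⁻¹)‖ ≤ C) ∧
    ∀ (s : S) (a : 𝒜.fiber s),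
      Tendsto (fun i => (ξ i).sum fun p x => (ξ i).sum fun t y =>
        𝒜.univRep.one (p * (s * t)⁻¹) * star (𝒜.univRep.op 1 x) * 𝒜.univRep.op s a *
          𝒜.univRep.op 1 y)
        atTop (𝓝 (𝒜.univRep.op s a))

end FellBundle

/-!
In the auxiliary space of the universal representation `ρ`, the vectors `V k = ∑ t, (ξ t k) δ_t`
form an operator `V` with `V* V` the sum in (i) and `V* (a δ_s) V` the sum in (ii). On `V k` the
action of `C_c(𝒜)` is bounded by a multiple of the reduced seminorm, because
`ξ t k ∈ A_{tt^*} H` lets one move each summand to the unit fibre, where it is a value of an element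
of `ℓ²(𝒜'')`. That multiple depends on `ξ` in an uncontrolled way, but the C*-identity removes it:
iterating `‖x v‖² ≤ ‖v‖ ‖x* x v‖` turns any bound `‖x v‖ ≤ D ‖x‖_r`, valid for all `x`, into
`‖x v‖ ≤ ‖x‖_r ‖v‖`. Hence `|⟪V h, x V k⟫| ≤ C ‖x‖_r ‖h‖ ‖k‖` uniformly along the net, and the limit
gives `‖ρ(x)‖ ≤ C ‖x‖_r`. As `ρ` is isometric on `C*(𝒜)`, the regular representation is bounded
below, and it has dense range.
-/

section PositiveFunctionals

open scoped ComplexOrder ComplexStarModule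

variable {A : Type v} [NonUnitalCStarAlgebra A]

/-- The complex-linear functional `x ↦ g (re x) + i g (im x)` that extends the restriction to the
self-adjoint part of a real functional `g`. -/
noncomputable def hermitianExtension (g : A →ₗ[ℝ] ℝ) : A →ₗ[ℂ] ℂ :=
  Module.Dual.extendRCLike (g ∘ₗ (selfAdjoint.submodule ℝ A).subtype ∘ₗ realPart)

theorem hermitianExtension_apply (g : A →ₗ[ℝ] ℝ) {x : A} (hx : IsSelfAdjoint x) :
    hermitianExtension g x = g x := by
  have hre : (ℜ x : A) = x := hx.coe_realPart
  have him : (ℜ (Complex.I • x) : A) = 0 := by simp [realPart_I_smul, hx.imaginaryPart]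
  change (g (ℜ x : A) : ℂ) - Complex.I * (g (ℜ (Complex.I • x) : A) : ℂ) = g x
  rw [hre, him, map_zero, Complex.ofReal_zero, mul_zero, sub_zero]

variable [PartialOrder A] [StarOrderedRing A]

theorem exists_positive_apply_ne_zero {c : A} (hc : 0 ≤ c) (hc0 : c ≠ 0) :
    ∃ f : A →ₚ[ℂ] ℂ, f c ≠ 0 := by
  have hneg : -c ∉ ProperCone.positive ℝ A := fun h =>
    hc0 (le_antisymm (neg_nonneg.mp (ProperCone.mem_positive.mp h)) hc)
  obtain ⟨g, hg, hgc⟩ := (ProperCone.positive ℝ A).hyperplane_separation_point hneg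
  have hpos : ∀ x : A, 0 ≤ x → 0 ≤ hermitianExtension (g : A →ₗ[ℝ] ℝ) x := fun x hx => by
    rw [hermitianExtension_apply _ (.of_nonneg hx)]
    exact Complex.zero_le_real.mpr (hg x hx)
  refine ⟨.mk₀ _ hpos, ?_⟩
  rw [map_neg, neg_lt_zero] at hgc
  change hermitianExtension (g : A →ₗ[ℝ] ℝ) c ≠ 0
  rw [hermitianExtension_apply _ (.of_nonneg hc)]
  exact Complex.ofReal_ne_zero.mpr hgc.ne'

theorem apply_star_mul_self_eq_zero_of_gns_eq_zero {f : A →ₚ[ℂ] ℂ} {b : A}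
    (hb : f.gnsNonUnitalStarAlgHom b = 0) (a : A) : f (star (b * a) * (b * a)) = 0 := by
  have hab : f.leftMulMapPreGNS b (f.toPreGNS a) = f.toPreGNS (b * a) := rfl
  have h := f.gnsNonUnitalStarAlgHom_apply_coe (a := b) (b := f.toPreGNS a)
  rw [hb, zero_apply, hab] at h
  have hnorm : ‖f.toPreGNS (b * a)‖ = 0 := by
    rw [← UniformSpace.Completion.norm_coe, ← h, norm_zero]
  simpa [hnorm] using (f.preGNS_norm_sq (f.toPreGNS (b * a))).symm

theorem eq_zero_of_forall_gns_eq_zero {b : A}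
    (hb : ∀ f : A →ₚ[ℂ] ℂ, f.gnsNonUnitalStarAlgHom b = 0) : b = 0 := by
  by_contra hb0
  have hne : star (b * star b) * (b * star b) ≠ 0 := by
    rwa [Ne, CStarRing.star_mul_self_eq_zero_iff, CStarRing.mul_star_self_eq_zero_iff]
  obtain ⟨f, hf⟩ := exists_positive_apply_ne_zero (star_mul_self_nonneg _) hne
  exact hf (apply_star_mul_self_eq_zero_of_gns_eq_zero (hb f) _)

end PositiveFunctionals

theorem apply_eq_zero_of_directSumRep_eq_zero {ι : Type u} {G : ι → Type v}
    [∀ i, NormedAddCommGroup (G i)] [∀ i, InnerProductSpace ℂ (G i)] [∀ i, CompleteSpace (G i)]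
    {B : Type w} [NonUnitalCStarAlgebra B] {ρ : ∀ i, B →⋆ₙₐ[ℂ] (G i →L[ℂ] G i)} {b : B}
    (hb : directSumRep ρ b = 0) (i : ι) : ρ i b = 0 := by
  classical
  ext k
  have h : directSumRep ρ b (lp.single 2 i k) i = ρ i b (lp.single 2 i k i) := rfl
  rw [lp.single_apply_self, hb] at h
  exact h.symm

namespace FellBundle

variable {S : Type u} [InverseMonoid S] (𝒜 : FellBundle.{u, v} S)

theorem univHom_injective : Function.Injective 𝒜.univHom :=
  (injective_iff_map_eq_zero _).mpr fun _ hb =>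
    eq_zero_of_forall_gns_eq_zero fun f => apply_eq_zero_of_directSumRep_eq_zero hb f

theorem norm_univHom (b : 𝒜.FullAlg) : ‖𝒜.univHom b‖ = ‖b‖ :=
  NonUnitalStarAlgHom.norm_map 𝒜.univHom 𝒜.univHom_injective b

end FellBundle

theorem le_of_forall_mul_pow_two_pow_le {a b c D : ℝ} (hb : 0 ≤ b) (hc : 0 < c)
    (h : ∀ n : ℕ, c * a ^ 2 ^ n ≤ D * b ^ 2 ^ n) : a ≤ b := by
  by_contra! hba
  have ha0 : 0 < a := hb.trans_lt hba
  have hlim : Filter.Tendsto (fun n : ℕ => D * (b / a) ^ 2 ^ n) Filter.atTop (nhds (D * 0)) :=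
    ((tendsto_pow_atTop_nhds_zero_of_lt_one (by positivity) ((div_lt_one ha0).mpr hba)).comp
      (tendsto_pow_atTop_atTop_of_one_lt one_lt_two)).const_mul D
  rw [mul_zero] at hlim
  refine hc.not_ge (ge_of_tendsto' hlim fun n => ?_)
  rw [div_pow, ← mul_div_assoc, le_div_iff₀ (by positivity)]
  exact h n

namespace CStarSeminorm

variable {Q : Type u} [NonUnitalRing Q] [StarRing Q]

section Representation

variable {K : Type w} [SeminormedAddCommGroup K] [InnerProductSpace ℂ K] {ρ : Q → K → K}

theorem sq_norm_apply_le (hmul : ∀ x y k, ρ (x * y) k = ρ x (ρ y k))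
    (hadj : ∀ x k l, inner ℂ (ρ x k) l = inner ℂ k (ρ (star x) l)) (x : Q) (k : K) :
    ‖ρ x k‖ ^ 2 ≤ ‖k‖ * ‖ρ (star x * x) k‖ := by
  rw [norm_sq_eq_re_inner (𝕜 := ℂ), hadj, ← hmul]
  exact (RCLike.re_le_norm _).trans (norm_inner_le_norm _ _)

variable [Module ℂ Q] (p : CStarSeminorm Q)

theorem norm_mul_norm_apply_pow_le (hmul : ∀ x y k, ρ (x * y) k = ρ x (ρ y k))
    (hadj : ∀ x k l, inner ℂ (ρ x k) l = inner ℂ k (ρ (star x) l)) {k : K} {D : ℝ}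
    (hD : ∀ x, ‖ρ x k‖ ≤ D * p.toSeminorm x) (n : ℕ) :
    ∀ x, ‖k‖ * ‖ρ x k‖ ^ 2 ^ n ≤ D * (p.toSeminorm x * ‖k‖) ^ 2 ^ n := by
  induction n with
  | zero =>
    intro x
    calc ‖k‖ * ‖ρ x k‖ ^ 2 ^ 0 = ‖k‖ * ‖ρ x k‖ := by rw [pow_zero, pow_one]
      _ ≤ ‖k‖ * (D * p.toSeminorm x) := by gcongr; exact hD x
      _ = D * (p.toSeminorm x * ‖k‖) ^ 2 ^ 0 := by ring
  | succ n ih =>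
    intro x
    calc ‖k‖ * ‖ρ x k‖ ^ 2 ^ (n + 1) = ‖k‖ * (‖ρ x k‖ ^ 2) ^ 2 ^ n := by rw [pow_succ', pow_mul]
      _ ≤ ‖k‖ * (‖k‖ * ‖ρ (star x * x) k‖) ^ 2 ^ n := by
        gcongr; exact sq_norm_apply_le hmul hadj x k
      _ = ‖k‖ ^ 2 ^ n * (‖k‖ * ‖ρ (star x * x) k‖ ^ 2 ^ n) := by ring
      _ ≤ ‖k‖ ^ 2 ^ n * (D * (p.toSeminorm (star x * x) * ‖k‖) ^ 2 ^ n) := by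
        exact mul_le_mul_of_nonneg_left (ih _) (by positivity)
      _ = ‖k‖ ^ 2 ^ n * (D * (p.toSeminorm x ^ 2 * ‖k‖) ^ 2 ^ n) := by
        rw [show p.toSeminorm (star x * x) = p.toSeminorm x ^ 2 from p.star_mul_self' x]
      _ = D * (p.toSeminorm x * ‖k‖) ^ 2 ^ (n + 1) := by rw [pow_succ' 2, pow_mul]; ring

theorem norm_apply_le_of_bound (hmul : ∀ x y k, ρ (x * y) k = ρ x (ρ y k))
    (hadj : ∀ x k l, inner ℂ (ρ x k) l = inner ℂ k (ρ (star x) l)) {k : K} {D : ℝ}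
    (hD : ∀ x, ‖ρ x k‖ ≤ D * p.toSeminorm x) (x : Q) : ‖ρ x k‖ ≤ p.toSeminorm x * ‖k‖ := by
  rcases (norm_nonneg k).eq_or_lt with hk | hk
  · have h := sq_norm_apply_le hmul hadj x k
    rw [← hk, zero_mul] at h
    rw [← hk, mul_zero, pow_eq_zero_iff two_ne_zero |>.mp (le_antisymm h (sq_nonneg _))]
  · exact le_of_forall_mul_pow_two_pow_le (by positivity) hk fun n =>
      p.norm_mul_norm_apply_pow_le hmul hadj hD n x

end Representation

section Completion

variable [Module ℂ Q] [IsScalarTower ℂ Q Q] [SMulCommClass ℂ Q Q] [StarModule ℂ Q]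
  {p q : CStarSeminorm Q} {h : ∀ x, q.toSeminorm x ≤ p.toSeminorm x}

theorem continuous_mapCompl : Continuous (mapCompl p q h) :=
  UniformSpace.Completion.continuous_map

theorem denseRange_toComplHom : DenseRange q.toComplHom :=
  UniformSpace.Completion.denseRange_coe (α := q.Carrier)

theorem denseRange_mapCompl : DenseRange (mapCompl p q h) :=
  q.denseRange_toComplHom.mono <| by
    rintro _ ⟨x, rfl⟩
    exact ⟨p.toComplHom x, mapCompl_toComplHom p q h x⟩

theorem norm_le_mul_norm_mapCompl {C : ℝ} (hC : ∀ x, p.toSeminorm x ≤ C * q.toSeminorm x)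
    (b : p.Compl) : ‖b‖ ≤ C * ‖mapCompl p q h b‖ := by
  have := continuous_mapCompl (h := h)
  induction b using p.denseRange_toComplHom.induction_on with
  | hp => exact isClosed_le (by fun_prop) (by fun_prop)
  | ih x => simpa only [mapCompl_toComplHom, norm_toComplHom] using hC x

theorem mapCompl_bijective {C : ℝ} (hC : ∀ x, p.toSeminorm x ≤ C * q.toSeminorm x) :
    Function.Bijective (mapCompl p q h) := by
  have hanti : AntilipschitzWith C.toNNReal (mapCompl p q h) :=
    AddMonoidHomClass.antilipschitz_of_bound _ fun b => (norm_le_mul_norm_mapCompl hC b).trans <| by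
      gcongr
      exact Real.le_coe_toNNReal C
  have hunif : UniformContinuous (mapCompl p q h) := UniformSpace.Completion.uniformContinuous_map
  refine ⟨hanti.injective, Set.range_eq_univ.mp ?_⟩
  rw [← (hanti.isClosed_range hunif).closure_eq, denseRange_mapCompl.closure_range]

end Completion

end CStarSeminorm

namespace FellBundle

variable {S : Type u} [InverseMonoid S] {𝒜 : FellBundle.{u, v} S}

namespace Rep

variable {H : Type w} [NormedAddCommGroup H] [InnerProductSpace ℂ H] [CompleteSpace H]
  (π : 𝒜.Rep H)

theorem auxAct_mul (x y : 𝒜.Cc) (k : π.Aux) :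
    π.auxAct (x * y) k = π.auxAct x (π.auxAct y k) := by
  induction x using Cc.induction with
  | zero => simp only [zero_mul, map_zero, LinearMap.zero_apply]
  | add x x' hx hx' => simp only [add_mul, map_add, LinearMap.add_apply, hx, hx']
  | single s a =>
    induction y using Cc.induction with
    | zero => simp only [mul_zero, map_zero, LinearMap.zero_apply]
    | add y y' hy hy' => simp only [mul_add, map_add, LinearMap.add_apply, hy, hy']
    | single t b =>
      obtain ⟨F, h, rfl⟩ := π.aux_eq_sum k
      simp only [map_sum, single_mul_single, auxAct_single, op_op_apply, mul_assoc]

theorem unitSpace_idem_mul_le {e : S} (he : e * e = e) (u : S) :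
    π.unitSpace (e * u) 1 ≤ π.unitSpace e 1 :=
  π.unitSpace_le (π.isClosed_unitSpace e 1) fun f hf ⟨g, _, hfg⟩ a x => by
    have hef : e * f = f := by rw [← hfg, ← mul_assoc, ← mul_assoc, he]
    exact π.mem_unitSpace hf (hef ▸ mul_idem_le e hf) a x

theorem one_idem_mul {e : S} (he : e * e = e) (u : S) :
    π.one (e * u) = π.one e * π.one u := by
  have he' : π.one e * π.one (e * u) = π.one (e * u) := by
    ext x
    exact π.one_apply_eq (π.unitSpace_idem_mul_le he u (π.one_apply_mem _ x))
  have hu : π.one u * π.one (e * u) = π.one (e * u) := π.one_mul_eq_of_le (idem_mul_le he u)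
  have heu : π.one (e * u) * (π.one e * π.one u) = π.one e * π.one u := by
    ext x
    exact π.one_apply_eq (π.one_mul_one_mem e u x)
  rw [← heu, ← mul_assoc, π.one_comm, he', π.one_comm, hu]

section ReducedBound

theorem inner_auxSingle_auxAct_of_mem {r : S} {h : H} (hh : h ∈ π.unitSpace (r * r⁻¹) 1)
    (x : 𝒜.Cc) : inner ℂ (π.auxSingle r h) (π.auxAct x (π.auxSingle r h)) =
      inner ℂ (π.auxSingle 1 h) (π.auxAct x (π.auxSingle 1 h)) := by
  induction x using Cc.induction with
  | zero => simp only [map_zero, LinearMap.zero_apply, inner_zero_right]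
  | add x y hx hy => simp only [map_add, LinearMap.add_apply, inner_add_right, hx, hy]
  | single s a =>
    have hinv : r * (s * r)⁻¹ = r * r⁻¹ * s⁻¹ := by rw [mul_inv_rev', mul_assoc]
    rw [auxAct_single, auxAct_single, inner_auxSingle, inner_auxSingle, link, link, hinv,
      π.one_idem_mul (idem_mul_inv r), mul_one, one_mul, mul_apply_eq_comp,
      ← π.one_isSymmetric, π.one_apply_eq hh]

theorem norm_auxAct_auxSingle_of_mem {r : S} {h : H} (hh : h ∈ π.unitSpace (r * r⁻¹) 1)
    (x : 𝒜.Cc) : ‖π.auxAct x (π.auxSingle r h)‖ = ‖π.auxAct x (π.auxSingle 1 h)‖ := by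
  rw [← sq_eq_sq₀ (norm_nonneg _) (norm_nonneg _), norm_sq_eq_re_inner (𝕜 := ℂ),
    norm_sq_eq_re_inner (𝕜 := ℂ), auxAct_adjoint, auxAct_adjoint, ← auxAct_mul, ← auxAct_mul,
    π.inner_auxSingle_auxAct_of_mem hh]

theorem op_mem_vnFiber {s : S} (a : 𝒜.fiber s) : π.op s a ∈ π.vnFiber s :=
  Submodule.le_topologicalClosure _ ⟨_, ⟨a, rfl⟩, rfl⟩

theorem exists_norm_auxAct_auxSingle_one_le (c : 𝒜.fiber 1) (h : H) :
    ∃ D, ∀ x, ‖π.auxAct x (π.auxSingle 1 (π.op 1 c h))‖ ≤ D * π.redSeminorm.toSeminorm x := by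
  let f : π.PreEll2 := ⟨_, π.single_mem_ccVN (π.op_mem_vnFiber c)⟩
  have hf : π.evalCLM (π.toCcVN f) h = π.auxSingle 1 (π.op 1 c h) := π.evalAt_single h 1 _
  refine ⟨‖f‖ * ‖h‖, fun x => ?_⟩
  calc ‖π.auxAct x (π.auxSingle 1 (π.op 1 c h))‖
      = ‖π.evalCLM (π.toCcVN (π.preAct x f)) h‖ := by rw [evalCLM_preAct, hf]
    _ ≤ ‖π.preAct x f‖ * ‖h‖ := by rw [norm_eq]; exact ContinuousLinearMap.le_opNorm _ _
    _ ≤ ‖π.regular x‖ * ‖f‖ * ‖h‖ := by gcongr; exact π.norm_preAct_le x f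
    _ = ‖f‖ * ‖h‖ * π.redSeminorm.toSeminorm x := by rw [redSeminorm_apply]; ring

theorem exists_norm_auxAct_auxSingle_le {r : S} {c : 𝒜.fiber 1}
    (hc : c ∈ Set.range (𝒜.incl (mul_inv_le_one r))) (h : H) :
    ∃ D, ∀ x, ‖π.auxAct x (π.auxSingle r (π.op 1 c h))‖ ≤ D * π.redSeminorm.toSeminorm x := by
  obtain ⟨D, hD⟩ := π.exists_norm_auxAct_auxSingle_one_le c h
  refine ⟨D, fun x => ?_⟩
  obtain ⟨b, rfl⟩ := hc
  have hmem : π.op 1 (𝒜.incl (mul_inv_le_one r) b) h ∈ π.unitSpace (r * r⁻¹) 1 := by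
    rw [π.op_incl]
    exact π.mem_unitSpace (idem_mul_inv r) (le_refl' _) b h
  rw [π.norm_auxAct_auxSingle_of_mem hmem]
  exact hD x

end ReducedBound

section Compression

/-- The vector `∑ t, (ξ t h) δ_t` of the auxiliary space. As a map of `h` it is the
Stinespring operator of `gram` and `average`, which are compressions by it of the identity and of
the action of `C_c(𝒜)`. -/
noncomputable def auxVector (ξ : S →₀ 𝒜.fiber 1) (h : H) : π.Aux :=
  ξ.sum fun t y => π.auxSingle t (π.op 1 y h)

/-- The sum `∑ p t, ξ(p)^* ξ(t) 1_{p t^*}` of condition (i). -/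
noncomputable def gram (ξ : S →₀ 𝒜.fiber 1) : H →L[ℂ] H :=
  ξ.sum fun p x => ξ.sum fun t y => star (π.op 1 x) * π.op 1 y * π.one (p * t⁻¹)

/-- The sum `∑ p t, 1_{p (s t)^*} ξ(p)^* a ξ(t)` of condition (ii). -/
noncomputable def average (ξ : S →₀ 𝒜.fiber 1) {s : S} (a : 𝒜.fiber s) : H →L[ℂ] H :=
  ξ.sum fun p x => ξ.sum fun t y =>
    π.one (p * (s * t)⁻¹) * star (π.op 1 x) * π.op s a * π.op 1 y

variable {π}

theorem inner_auxVector (ξ : S →₀ 𝒜.fiber 1) (h k : H) :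
    inner ℂ (π.auxVector ξ h) (π.auxVector ξ k) = inner ℂ h (π.gram ξ k) := by
  simp only [auxVector, gram, Finsupp.sum, sum_apply, sum_inner, inner_sum, inner_auxSingle, link,
    mul_assoc, mul_apply_eq_comp, ContinuousLinearMap.star_eq_adjoint,
    ContinuousLinearMap.adjoint_inner_right, π.one_op_apply (mul_one 1)]
  exact Finset.sum_comm

theorem inner_auxVector_auxAct_single (ξ : S →₀ 𝒜.fiber 1) {s : S} (a : 𝒜.fiber s) (h k : H) :
    inner ℂ (π.auxVector ξ h) (π.auxAct (𝒜.single s a) (π.auxVector ξ k)) =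
      inner ℂ h (π.average ξ a k) := by
  simp only [auxVector, average, Finsupp.sum, map_sum, sum_apply, sum_inner, inner_sum,
    auxAct_single, inner_auxSingle, link, mul_apply_eq_comp, ContinuousLinearMap.star_eq_adjoint,
    ← π.one_isSymmetric, ContinuousLinearMap.adjoint_inner_right, π.one_op_apply (mul_one 1)]
  exact Finset.sum_comm

theorem sq_norm_auxVector_le (ξ : S →₀ 𝒜.fiber 1) (h : H) :
    ‖π.auxVector ξ h‖ ^ 2 ≤ ‖π.gram ξ‖ * ‖h‖ ^ 2 :=
  calc ‖π.auxVector ξ h‖ ^ 2 = RCLike.re (inner ℂ h (π.gram ξ h)) := by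
        rw [norm_sq_eq_re_inner (𝕜 := ℂ), inner_auxVector]
    _ ≤ ‖h‖ * ‖π.gram ξ h‖ := (RCLike.re_le_norm _).trans (norm_inner_le_norm _ _)
    _ ≤ ‖h‖ * (‖π.gram ξ‖ * ‖h‖) := by gcongr; exact (π.gram ξ).le_opNorm h
    _ = ‖π.gram ξ‖ * ‖h‖ ^ 2 := by ring

theorem norm_auxAct_auxVector_le {ξ : S →₀ 𝒜.fiber 1}
    (hξ : ∀ s, ξ s ∈ Set.range (𝒜.incl (mul_inv_le_one s))) (x : 𝒜.Cc) (h : H) :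
    ‖π.auxAct x (π.auxVector ξ h)‖ ≤ π.redSeminorm.toSeminorm x * ‖π.auxVector ξ h‖ := by
  choose D hD using fun r => π.exists_norm_auxAct_auxSingle_le (hξ r) h
  refine π.redSeminorm.norm_apply_le_of_bound π.auxAct_mul π.auxAct_adjoint
    (D := ∑ r ∈ ξ.support, D r) (fun y => ?_) x
  rw [auxVector, Finsupp.sum, map_sum, Finset.sum_mul]
  exact norm_sum_le_of_le _ fun r _ => hD r y

theorem norm_inner_auxVector_auxAct_le {ξ : S →₀ 𝒜.fiber 1}
    (hξ : ∀ s, ξ s ∈ Set.range (𝒜.incl (mul_inv_le_one s))) (x : 𝒜.Cc) (h k : H) :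
    ‖inner ℂ (π.auxVector ξ h) (π.auxAct x (π.auxVector ξ k))‖ ≤
      ‖π.gram ξ‖ * π.redSeminorm.toSeminorm x * (‖h‖ * ‖k‖) := by
  have hvec (h : H) : ‖π.auxVector ξ h‖ ≤ √‖π.gram ξ‖ * ‖h‖ := by
    rw [← Real.sqrt_sq (norm_nonneg h), ← Real.sqrt_mul (norm_nonneg _)]
    exact Real.le_sqrt_of_sq_le (sq_norm_auxVector_le ξ h)
  calc ‖inner ℂ (π.auxVector ξ h) (π.auxAct x (π.auxVector ξ k))‖
      ≤ ‖π.auxVector ξ h‖ * ‖π.auxAct x (π.auxVector ξ k)‖ := norm_inner_le_norm _ _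
    _ ≤ (√‖π.gram ξ‖ * ‖h‖) * (π.redSeminorm.toSeminorm x * (√‖π.gram ξ‖ * ‖k‖)) := by
      gcongr
      · exact hvec h
      · exact (norm_auxAct_auxVector_le hξ x k).trans (by gcongr; exact hvec k)
    _ = (√‖π.gram ξ‖ * √‖π.gram ξ‖) * π.redSeminorm.toSeminorm x * (‖h‖ * ‖k‖) := by ring
    _ = ‖π.gram ξ‖ * π.redSeminorm.toSeminorm x * (‖h‖ * ‖k‖) := by
      rw [Real.mul_self_sqrt (norm_nonneg _)]

end Compression

section Limit

open Filter Topology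

/-- The integrated form `∑ a δ_s ↦ ∑ π_s(a)` of the representation `π`. -/
noncomputable def integrate : 𝒜.Cc →ₗ[ℂ] (H →L[ℂ] H) := 𝒜.lift π.op

variable {π} {I : Type*} {l : Filter I} {ξ : I → S →₀ 𝒜.fiber 1}

theorem tendsto_inner_auxVector_auxAct
    (hlim : ∀ s (a : 𝒜.fiber s),
      Tendsto (fun i => toWOT (π.average (ξ i) a)) l (𝓝 (toWOT (π.op s a))))
    (x : 𝒜.Cc) (h k : H) :
    Tendsto (fun i => inner ℂ (π.auxVector (ξ i) h) (π.auxAct x (π.auxVector (ξ i) k))) l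
      (𝓝 (inner ℂ h (π.integrate x k))) := by
  induction x using Cc.induction with
  | zero => simpa only [map_zero, LinearMap.zero_apply, zero_apply, inner_zero_right] using
      tendsto_const_nhds
  | add x y hx hy =>
    simpa only [map_add, LinearMap.add_apply, add_apply, inner_add_right] using hx.add hy
  | single s a =>
    simp only [inner_auxVector_auxAct_single, integrate, lift_single]
    exact ContinuousLinearMapWOT.tendsto_iff_forall_inner_apply_tendsto.mp (hlim s a) k h

theorem norm_integrate_le [l.NeBot]
    (hξ : ∀ i s, ξ i s ∈ Set.range (𝒜.incl (mul_inv_le_one s)))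
    {C : ℝ} (hC : ∀ᶠ i in l, ‖π.gram (ξ i)‖ ≤ C)
    (hlim : ∀ s (a : 𝒜.fiber s),
      Tendsto (fun i => toWOT (π.average (ξ i) a)) l (𝓝 (toWOT (π.op s a))))
    (x : 𝒜.Cc) : ‖π.integrate x‖ ≤ C * π.redSeminorm.toSeminorm x := by
  have hC0 : 0 ≤ C := let ⟨_, hi⟩ := hC.exists; (norm_nonneg _).trans hi
  refine ContinuousLinearMap.opNorm_le_of_re_inner_le (by positivity) fun k h hk hh => ?_
  rw [inner_re_symm]
  refine (RCLike.re_le_norm _).trans <|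
    le_of_tendsto (tendsto_inner_auxVector_auxAct hlim x h k).norm (hC.mono fun i hi => ?_)
  calc ‖inner ℂ (π.auxVector (ξ i) h) (π.auxAct x (π.auxVector (ξ i) k))‖
      ≤ ‖π.gram (ξ i)‖ * π.redSeminorm.toSeminorm x * (‖h‖ * ‖k‖) :=
        norm_inner_auxVector_auxAct_le (hξ i) x h k
    _ ≤ C * π.redSeminorm.toSeminorm x := by rw [hh, hk, mul_one, mul_one]; gcongr

end Limit

end Rep

end FellBundle

namespace FellBundle

variable {S : Type u} [InverseMonoid S]

theorem univRep_integrate (𝒜 : FellBundle.{u, v} S) (x : 𝒜.Cc) :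
    𝒜.univRep.integrate x = 𝒜.univHom (𝒜.maxSeminorm.toComplHom x) := by
  induction x using Cc.induction with
  | zero => simp only [map_zero]
  | add x y hx hy => simp only [map_add, hx, hy]
  | single s a => exact lift_single ..

theorem norm_univRep_integrate (𝒜 : FellBundle.{u, v} S) (x : 𝒜.Cc) :
    ‖𝒜.univRep.integrate x‖ = 𝒜.maxSeminorm.toSeminorm x := by
  rw [univRep_integrate, norm_univHom, CStarSeminorm.norm_toComplHom]

end FellBundle

open Filter Topology FellBundle.Rep in
theorem theorem5p3_general {S : Type u} [InverseMonoid S] (𝒜 : FellBundle.{u, v} S) {I : Type w}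
    {l : Filter I} [l.NeBot] {ξ : I → S →₀ 𝒜.fiber 1}
    (hξ : ∀ i s, ξ i s ∈ Set.range (𝒜.incl (mul_inv_le_one s)))
    {C : ℝ} (hC : ∀ᶠ i in l, ‖𝒜.univRep.gram (ξ i)‖ ≤ C)
    (hlim : ∀ s (a : 𝒜.fiber s),
      Tendsto (fun i => toWOT (𝒜.univRep.average (ξ i) a)) l (𝓝 (toWOT (𝒜.univRep.op s a)))) :
    𝒜.HasWeakContainmentProperty :=
  CStarSeminorm.mapCompl_bijective fun x => by
    rw [← 𝒜.norm_univRep_integrate]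
    exact norm_integrate_le hξ hC hlim x

theorem theorem5p3 {S : Type u} [InverseMonoid S] (𝒜 : FellBundle.{u, v} S)
    (h : 𝒜.HasApproximationProperty.{u, v, w}) : 𝒜.HasWeakContainmentProperty := by
  obtain ⟨I, _, _, _, ξ, hξ, ⟨C, hC⟩, hlim⟩ := h
  exact theorem5p3_general 𝒜 (l := Filter.atTop) hξ (.of_forall hC) fun s a =>
    (ContinuousLinearMapWOT.continuous_ofCLM.tendsto _).comp (hlim s a)
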